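/- A matching problem $(G,\lambda)$ consists of a finite simple graph $G=(V,E)$ (the compatibility graph) and a vector $\lambda=(\lambda_i)_{i\in V}$ of positive arrival rates. A policy adapted to $G$ consists of a countably infinite state space $\mathcal S$, a map $|\cdot|:\mathcal S\to\mathbb N^V$ (the numbers of unmatched items of each class) such that there is a unique state $\varnothing$ with $|\varnothing|=0$, and, for each $s\in\mathcal S$ and $i\in V$, a probability distribution $\Phi(s,i,\cdot,\cdot)$ on $(V\cup\{\bot\})\times\mathcal S$ such that $\Phi(s,i,j,s')>0$ only if either $j=\bot$ and $|s'|=|s|+\mathbb 1_i$, or $j\in V$ is adjacent to $i$, $|s|_j\ge 1$ and $|s'|=|s|-\mathbb 1_j$. The dynamics started from $S_0=s_0$ are as follows: given the past, the class $I_t$ of the incoming item equals $i$ with probability $\lambda_i/\sum_{\ell}\lambda_\ell$, and the pair $(J_t,S_{t+1})$ of matching decision and next state then has law $\Phi(S_t,I_t,\cdot,\cdot)$; the Markov chain $(S_t)_{t\in\mathbb N}$ is assumed irreducible on $\mathcal S$. The policy is stable (for $(G,\lambda)$) if $(S_t)$ is positive recurrent, and greedy if $\sum_{s'}\Phi(s,i,\bot,s')=0$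 whenever some neighbor $j$ of $i$ has $|s|_j\ge1$. The problem $(G,\lambda)$ is stabilizable if it admits a stable policy (greedy or not). The matching rate vector $\mu(\Phi)\in\mathbb R^E$ of a stable policy is defined by the almost sure limits, from $S_0=\varnothing$, $$\mu_e=\Big(\sum_{i\in V}\lambda_i\Big)\lim_{t\to\infty}\frac1t\,\#\{u<t:\ J_u\neq\bot,\ \{I_u,J_u\}=e\},\qquad e\in E .$$ Let $A\in\{0,1\}^{V\times E}$ be the incidence matrix of $G$; $G$ is surjective-only if $y\mapsto Ay$, $\mathbb R^E\to\mathbb R^V$, is surjective but not injective. Put $\Pi=\{y\in\mathbb R^E: Ay=\lambda\}$, $\Pi_{\ge0}=\{y\in\Pi: y\ge 0\}$, $\Pi_{>0}=\{y\in\Pi: y_e>0\ \text{for all } e\in E\}$, and let $\Pi_{\mathrm{Gre}}$ be the set of matching rate vectors of stable greedy policies adapted to $G$. **Proposition.** Let $G$ be surjective-only and let $(G,\lambda)$ be stabilizable. Then every stable greedy policy has a unique (well-defined) matching rate vector, the set $\Pi_{\mathrm{Gre}}$ is non-empty, and $\Pi_{\mathrm{Gre}}\subseteq\Pi_{>0}$,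 where $\Pi_{>0}$ is open in the affine space $\Pi$. In particular, $\Pi_{\mathrm{Gre}}$ is disjoint from the (relative) boundary of the polytope $\Pi_{\ge0}$. -/

import Mathlib

open MeasureTheory ProbabilityTheory Filter Topology
open scoped ENNReal

/-- A matching problem `(G, λ)`: a simple compatibility graph on the classes `V` and a positive
arrival rate for each class. -/
structure MatchingProblem (V : Type*) where
  graph : SimpleGraph V
  rate : V → ℝ
  rate_pos : ∀ i, 0 < rate i

/-- A matching policy adapted to `G` (random, and with an arbitrary countably infinite state
space). Without loss of generality a countable state space lives in `Type`.
`law s i` is the joint law of the matching decision (`none` : the incoming item is queued;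
`some j` : it is matched with an unmatched item of class `j`) and of the next state, when an item of
class `i` arrives in state `s`, that is, `Φ(s, i, j, s') = law s i (j, s')`. -/
structure MatchingPolicy {V : Type*} (G : SimpleGraph V) where
  /-- the state space -/
  State : Type
  countable_state : Countable State
  infinite_state : Infinite State
  /-- the number of unmatched items of each class -/
  queue : State → V → ℕ
  /-- the unique state without unmatched items -/
  empty : State
  queue_eq_zero_iff : ∀ s, queue s = 0 ↔ s = empty
  law : State → V → PMF (Option V × State)
  /-- if the item is queued, its queue grows by one -/
  queue_none : ∀ s i s', law s i (none, s') ≠ 0 → ∀ k,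
    queue s' k = queue s k + (open Classical in if k = i then 1 else 0)
  /-- the item may only be matched with an unmatched item of a compatible class,
  which then leaves its queue -/
  adapted : ∀ s i j s', law s i (some j, s') ≠ 0 → G.Adj i j ∧ 1 ≤ queue s j
  queue_some : ∀ s i j s', law s i (some j, s') ≠ 0 → ∀ k,
    queue s' k + (open Classical in if k = j then 1 else 0) = queue s k
  /-- The Markov chain of states is irreducible. All arrival rates being positive, `s → s'` is a
  transition of positive probability iff some arrival and some decision lead from `s` to `s'`. -/
  irreducible : ∀ s s', Relation.ReflTransGen (fun a b => ∃ i j, law a i (j, b) ≠ 0) s s'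

/-- One step of the matching dynamics: the class `I_t` of the incoming item, the decision `J_t`, and
the state `S_{t+1}` right after that decision. -/
structure MatchingStep (V : Type*) (S : Type) where
  arrival : V
  decision : Option V
  next : S

instance MatchingStep.instMeasurableSpace {V : Type*} {S : Type} :
    MeasurableSpace (MatchingStep V S) := ⊤

namespace MatchingPolicy

variable {V : Type*} {G : SimpleGraph V} (Φ : MatchingPolicy G)

instance : Countable Φ.State := Φ.countable_state

instance : MeasurableSpace Φ.State := ⊤

instance : DiscreteMeasurableSpace Φ.State := ⟨fun _ => trivial⟩

/-- An incoming item is matched whenever there is a compatible unmatched item. -/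
def IsGreedy : Prop :=
  ∀ s i, (∃ j, G.Adj i j ∧ 1 ≤ Φ.queue s j) → ∑' s', Φ.law s i (none, s') = 0

end MatchingPolicy

namespace MatchingProblem

variable {V : Type*} [Fintype V] (M : MatchingProblem V)

/-- The law of the class of an incoming item: class `i` has probability `λ_i / ∑ j, λ_j`. -/
noncomputable def arrivalLaw [Nonempty V] : PMF V :=
  PMF.normalize (fun i => ENNReal.ofReal (M.rate i))
    (by
      obtain ⟨i⟩ := ‹Nonempty V›
      intro h
      have := ENNReal.tsum_eq_zero.mp h i
      rw [ENNReal.ofReal_eq_zero] at this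
      exact absurd (M.rate_pos i) (not_lt.mpr this))
    (by
      rw [tsum_fintype]
      exact (ENNReal.sum_lt_top.mpr fun i _ => ENNReal.ofReal_lt_top).ne)

section Chain

variable [Nonempty V] (Φ : MatchingPolicy M.graph)

/-- The law of `(I_t, J_t, S_{t+1})` given `S_t = s`: the incoming class is independent of the
state, and `(J_t, S_{t+1})` then has law `Φ(s, I_t, ·, ·)`. -/
noncomputable def stepLaw (s : Φ.State) : PMF (MatchingStep V Φ.State) :=
  M.arrivalLaw.bind fun i => (Φ.law s i).map fun p => ⟨i, p.1, p.2⟩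

/-- `stepLaw` as a Markov kernel. -/
noncomputable def stepKernel : Kernel Φ.State (MatchingStep V Φ.State) :=
  Kernel.ofFunOfCountable fun s => (M.stepLaw Φ s).toMeasure

instance : IsMarkovKernel (M.stepKernel Φ) :=
  ⟨fun s => inferInstanceAs (IsProbabilityMeasure (M.stepLaw Φ s).toMeasure)⟩

/-- The next step depends on the past only through the current state. -/
noncomputable def historyKernel (n : ℕ) :
    Kernel (Π _ : Finset.Iic n, MatchingStep V Φ.State) (MatchingStep V Φ.State) :=
  (M.stepKernel Φ).comap
    (fun h => (h ⟨n, Finset.mem_Iic.mpr le_rfl⟩).next)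
    ((show Measurable (MatchingStep.next : MatchingStep V Φ.State → Φ.State) from
      measurable_from_top).comp (measurable_pi_apply _))

instance (n : ℕ) : IsMarkovKernel (M.historyKernel Φ n) :=
  inferInstanceAs (IsMarkovKernel (Kernel.comap _ _ _))

/-- The law of the trajectory `t ↦ (I_t, J_t, S_{t+1})` of the model `(G, λ, Φ)`
started in the state `S_0 = s`. -/
noncomputable def pathMeasure (s : Φ.State) : Measure (ℕ → MatchingStep V Φ.State) :=
  Kernel.trajMeasure (X := fun _ => MatchingStep V Φ.State)
    (M.stepLaw Φ s).toMeasure (M.historyKernel Φ)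

/-- The time `inf {t ≥ 1 : S_t = s}`, with value `∞` if there is no such `t`
(recall that `S_{t+1} = (ω t).next`). -/
noncomputable def hittingTime {V : Type*} {S : Type} (s : S) (ω : ℕ → MatchingStep V S) : ℝ≥0∞ :=
  ⨅ (t : ℕ) (_ : (ω t).next = s), ((t + 1 : ℕ) : ℝ≥0∞)

/-- The model `(G, λ, Φ)` is stable: the (irreducible) Markov chain of states is positive recurrent,
that is, the mean return time to each state is finite. -/
def IsStable : Prop :=
  ∀ s : Φ.State, ∫⁻ ω, hittingTime s ω ∂(M.pathMeasure Φ s) < ∞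

/-- The number `M_{t,e}` of matches along the edge `e` over the first `t` arrivals. -/
noncomputable def matchCount {V : Type*} {S : Type} (ω : ℕ → MatchingStep V S) (t : ℕ)
    (e : Sym2 V) : ℕ :=
  open Classical in
  ((Finset.range t).filter fun u => ∃ j, (ω u).decision = some j ∧ s((ω u).arrival, j) = e).card

/-- `μ` is the vector of matching rates of the model `(G, λ, Φ)`, started empty: for each edge `e`,
`(∑ i, λ_i) * M_{t,e} / t` converges to `μ_e` almost surely. -/
def HasMatchingRates (μ : M.graph.edgeSet → ℝ) : Prop :=
  ∀ e : M.graph.edgeSet, ∀ᵐ ω ∂(M.pathMeasure Φ Φ.empty),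
    Tendsto (fun t : ℕ => (∑ i, M.rate i) * ((matchCount ω t e : ℝ) / (t : ℝ)))
      atTop (𝓝 (μ e))

/-- The problem `(G, λ)` is stabilizable: some policy, greedy or not, makes it stable. -/
def IsStabilizable : Prop := ∃ Φ : MatchingPolicy M.graph, M.IsStable Φ

/-- `Π_Gre`: the matching rate vectors of stable greedy policies. -/
def greedyRates : Set (M.graph.edgeSet → ℝ) :=
  {μ | ∃ Φ : MatchingPolicy M.graph, Φ.IsGreedy ∧ M.IsStable Φ ∧ M.HasMatchingRates Φ μ}

end Chain

end MatchingProblem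

namespace SimpleGraph

variable {V : Type*} [Fintype V] (G : SimpleGraph V)

open Classical in
/-- The incidence matrix with rows indexed by the nodes and columns indexed by the edges. -/
noncomputable def edgeIncMatrix : Matrix V G.edgeSet ℝ :=
  (G.incMatrix ℝ).submatrix id Subtype.val

open Classical in
/-- The linear map `y ↦ A y` given by the incidence matrix. -/
noncomputable def incMap : (G.edgeSet → ℝ) →ₗ[ℝ] (V → ℝ) := G.edgeIncMatrix.mulVecLin

/-- `G` is surjective but not injective. -/
def IsSurjectiveOnly : Prop :=
  Function.Surjective G.incMap ∧ ¬ Function.Injective G.incMap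

end SimpleGraph

namespace MatchingProblem

variable {V : Type*} [Fintype V] (M : MatchingProblem V)

/-- `Π`: the solutions of the conservation equation `A y = λ`. -/
def solutions : Set (M.graph.edgeSet → ℝ) := {y | M.graph.incMap y = M.rate}

/-- `Π_{≥ 0}`: the polytope of nonnegative solutions of the conservation equation. -/
def nonnegSolutions : Set (M.graph.edgeSet → ℝ) := {y ∈ M.solutions | ∀ e, 0 ≤ y e}

/-- `Π_{> 0}`: the positive solutions of the conservation equation. -/
def posSolutions : Set (M.graph.edgeSet → ℝ) := {y ∈ M.solutions | ∀ e, 0 < y e}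

end MatchingProblem

/-!
The proof reduces every claim to the excursions of the chain of states from the empty state.

*Rates.* By the Markov property, the trajectory after the first return to the empty state is
independent of the first excursion and has the law of the whole trajectory
(`IsTrajectoryLaw.measure_regeneration`). The numbers of matches along an edge in the successive
excursions are therefore independent and identically distributed, and so are the lengths of the
excursions, which have a finite mean by stability. The strong law of large numbers gives the
matching rates (`IsTrajectoryLaw.tendsto_sum_div`, `IsStable.hasMatchingRates`). They are the mean
numbers of matches under the invariant probability `π`, where `π s` is the mean number of visits to
`s` in an excursion divided by the mean length of the excursion. The queues are empty at both ends
of an excursion, hence the rates solve the conservation equation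
(`IsStable.excursionRates_mem_solutions`). The rate of an edge is positive as soon as the policy
uses the edge in some state, since `π` charges all states. A greedy policy uses each edge `ij`: it
does when items of the classes `i` and `j` arrive one after the other in the empty system. This
proves that the rates of a stable greedy policy belong to `Π_{>0}`.

*Existence of a stable greedy policy.* A stable policy which is not greedy may leave some edges
unused. Suppose that weights `x` of the classes satisfy `x i + x j = 0` on all used edges `ij`. Then
the total weight of the unmatched items is a random walk with steps `x i`, and a random walk with
nonzero steps cannot be a function of a chain with an invariant probability: the most likely value
would have infinitely many translates with the same probability (`IsStable.weight_eq_zero`).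
Therefore `x = 0`, which means that the used edges already make the incidence map surjective, and a
small shift of the rates makes all edges positive (`IsStable.posSolutions_nonempty`). Finally, given
a positive solution, the sum of the squares of the queues is a Lyapunov function for the greedy
policy which matches each item with a longest compatible queue
(`SimpleGraph.exists_sum_queue_le`). Foster's criterion provides an invariant probability
(`exists_isInvariant_of_drift`), and Kac's formula turns it into positive recurrence
(`isStable_matchLongest`).

*Topology.* Finitely many strict inequalities define an open set. The affine span of `Π_{≥0}` lies
in `Π`, so that `Π_{>0}` is contained in the intrinsic interior of `Π_{≥0}`.
-/

/-! ### Return times and invariant vectors of countable Markov chains -/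

namespace MarkovChain

variable {S : Type*}

/-- `π` is an invariant vector of the transition matrix `P`. -/
def IsInvariant (P : S → PMF S) (π : S → ℝ≥0∞) : Prop :=
  ∀ t, ∑' s, π s * P s t = π t

open Classical in
/-- The mean value of `h` at the state at time `k`, starting from `s`, on the event that the chain
avoids `x` at the times `1, …, k`. -/
noncomputable def killed (P : S → PMF S) (x : S) (h : S → ℝ≥0∞) : ℕ → S → ℝ≥0∞
  | 0, s => h s
  | k + 1, s => ∑' t, P s t * (if t = x then 0 else killed P x h k t)

/-- The probability, starting from `s`, that the chain avoids `x` at the times `1, …, k`. -/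
noncomputable def survival (P : S → PMF S) (x : S) (k : ℕ) (s : S) : ℝ≥0∞ :=
  killed P x (fun _ => 1) k s

open Classical in
/-- The probability, starting from `x`, that the chain is in the state `s` at time `k` and has not
returned to `x` at the times `1, …, k`. -/
noncomputable def taboo (P : S → PMF S) (x : S) : ℕ → S → ℝ≥0∞
  | 0, s => if s = x then 1 else 0
  | k + 1, t => if t = x then 0 else ∑' s, taboo P x k s * P s t

/-- The mean number of visits to `s` between two visits to `x`. -/
noncomputable def occupation (P : S → PMF S) (x s : S) : ℝ≥0∞ := ∑' k, taboo P x k s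

variable (P : S → PMF S)

open Classical in
lemma survival_succ (x : S) (k : ℕ) (s : S) :
    survival P x (k + 1) s = ∑' t, P s t * (if t = x then 0 else survival P x k t) := rfl

lemma survival_zero (x s : S) : survival P x 0 s = 1 := rfl

lemma tsum_mul_transition (π : S → ℝ≥0∞) (h : S → ℝ≥0∞) :
    ∑' t, (∑' s, π s * P s t) * h t = ∑' s, π s * ∑' t, P s t * h t := by
  simp_rw [← ENNReal.tsum_mul_right, ← ENNReal.tsum_mul_left, mul_assoc]
  exact ENNReal.tsum_comm

variable {P}

lemma IsInvariant.tsum_mul {π : S → ℝ≥0∞} (hπ : IsInvariant P π) (h : S → ℝ≥0∞) :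
    ∑' s, π s * ∑' t, P s t * h t = ∑' t, π t * h t := by
  rw [← tsum_mul_transition]
  exact tsum_congr fun t => by rw [hπ t]

lemma IsInvariant.pos_of_step {π : S → ℝ≥0∞} (hπ : IsInvariant P π) {a b : S} (ha : π a ≠ 0)
    (hab : P a b ≠ 0) : π b ≠ 0 := by
  intro h
  rw [← hπ b, ENNReal.tsum_eq_zero] at h
  exact mul_ne_zero ha hab (h a)

lemma IsInvariant.pos_of_reachable {π : S → ℝ≥0∞} (hπ : IsInvariant P π) {a b : S} (ha : π a ≠ 0)
    (hab : Relation.ReflTransGen (fun a b => P a b ≠ 0) a b) : π b ≠ 0 := by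
  induction hab with
  | refl => exact ha
  | tail _ h ih => exact hπ.pos_of_step ih h

/-- Half of Kac's formula: the mean return time to `x` is at most `1 / π x`. The numbers
`b k = P_π(S_1 ≠ x, …, S_k ≠ x)` satisfy `π x * P_x(T_x > k) + b (k + 1) = b k`. -/
lemma IsInvariant.tsum_survival_lt_top {π : S → ℝ≥0∞} (hπ : IsInvariant P π)
    (hsum : ∑' s, π s = 1) {x : S} (hx : π x ≠ 0) : ∑' k, survival P x k x < ∞ := by
  classical
  set b : ℕ → ℝ≥0∞ := fun k => ∑' s, π s * survival P x k s with hb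
  have hstep : ∀ k, π x * survival P x k x + b (k + 1) = b k := by
    intro k
    have h1 : b (k + 1) = ∑' t, π t * (if t = x then 0 else survival P x k t) := by
      rw [← hπ.tsum_mul]
      rfl
    have h2 : b k = ∑' s, π s * survival P x k s := rfl
    rw [h1, h2, ENNReal.tsum_eq_add_tsum_ite (f := fun s => π s * survival P x k s) x]
    congr 1
    exact tsum_congr fun t => by split_ifs <;> simp
  have hle : ∀ n, ∑ k ∈ Finset.range n, π x * survival P x k x + b n = b 0 := by
    intro n
    induction n with
    | zero => simp
    | succ n ih => rw [Finset.sum_range_succ, add_assoc, hstep, ih]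
  have hb0 : b 0 = 1 := by simp [hb, survival_zero, hsum]
  have hle' : π x * ∑' k, survival P x k x ≤ 1 := by
    rw [← ENNReal.tsum_mul_left]
    refine ENNReal.tsum_le_of_sum_range_le fun n => ?_
    rw [← hb0, ← hle n]
    exact le_self_add
  by_contra h
  rw [not_lt, top_le_iff] at h
  rw [h, ENNReal.mul_top hx] at hle'
  exact absurd hle' (by simp)

variable (P)

lemma tsum_taboo_succ_mul_killed (x : S) (h : S → ℝ≥0∞) (k j : ℕ) :
    ∑' s, taboo P x (k + 1) s * killed P x h j s
      = ∑' s, taboo P x k s * killed P x h (j + 1) s := by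
  classical
  simp only [taboo, killed]
  rw [← tsum_mul_transition]
  exact tsum_congr fun t => by split_ifs <;> simp

lemma tsum_taboo_mul (x : S) (h : S → ℝ≥0∞) (k : ℕ) :
    ∑' s, taboo P x k s * h s = killed P x h k x := by
  classical
  have H : ∀ k j, ∑' s, taboo P x k s * killed P x h j s = killed P x h (k + j) x := by
    intro k
    induction k with
    | zero => intro j; simp [taboo]
    | succ k ih => intro j; rw [tsum_taboo_succ_mul_killed, ih, add_right_comm, add_assoc]
  simpa [killed] using H k 0

lemma tsum_taboo (x : S) (k : ℕ) : ∑' s, taboo P x k s = survival P x k x := by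
  simpa [survival] using tsum_taboo_mul P x (fun _ => 1) k

lemma tsum_occupation_mul (x : S) (h : S → ℝ≥0∞) :
    ∑' s, occupation P x s * h s = ∑' k, killed P x h k x := by
  simp only [occupation, ← ENNReal.tsum_mul_right]
  rw [ENNReal.tsum_comm]
  exact tsum_congr fun k => tsum_taboo_mul P x h k

lemma tsum_occupation (x : S) : ∑' s, occupation P x s = ∑' k, survival P x k x := by
  simp only [occupation]
  rw [ENNReal.tsum_comm]
  exact tsum_congr fun k => tsum_taboo P x k

lemma occupation_self (x : S) : occupation P x x = 1 := by
  classical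
  rw [occupation, tsum_eq_single 0]
  · simp [taboo]
  · intro k hk
    obtain ⟨k, rfl⟩ := Nat.exists_eq_succ_of_ne_zero hk
    simp [taboo]

variable {P}

/-- If the mean return time to `x` is finite, then the occupation vector of an excursion from `x` is
invariant. -/
lemma isInvariant_occupation {x : S} (hx : ∑' k, survival P x k x < ∞) :
    IsInvariant P (occupation P x) := by
  classical
  have hne : ∀ t, t ≠ x → ∑' s, occupation P x s * P s t = occupation P x t := by
    intro t ht
    simp only [occupation]
    rw [tsum_eq_zero_add' (f := fun k => taboo P x k t) ENNReal.summable]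
    simp_rw [← ENNReal.tsum_mul_right]
    rw [ENNReal.tsum_comm]
    simp [taboo, ht]
  intro t
  rcases ne_or_eq t x with ht | rfl
  · exact hne t ht
  -- Both vectors have the same finite total mass, and they agree off `x`.
  have h1 : ∑' u, ∑' s, occupation P t s * P s u = ∑' s, occupation P t s := by
    rw [ENNReal.tsum_comm]
    simp_rw [ENNReal.tsum_mul_left, PMF.tsum_coe, mul_one]
  rw [ENNReal.tsum_eq_add_tsum_ite (f := fun u => ∑' s, occupation P t s * P s u) t,
    ENNReal.tsum_eq_add_tsum_ite (f := fun s => occupation P t s) t] at h1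
  have h2 : (∑' u, if u = t then 0 else ∑' s, occupation P t s * P s u)
      = ∑' u, if u = t then 0 else occupation P t u :=
    tsum_congr fun u => by
      split_ifs with h
      · rfl
      · exact hne u h
  rw [h2] at h1
  refine (ENNReal.add_left_inj ?_).mp h1
  refine ne_top_of_le_ne_top hx.ne ?_
  rw [← tsum_occupation]
  exact ENNReal.tsum_le_tsum fun u => by split_ifs <;> simp

lemma survival_succ_le (x : S) (k : ℕ) (s : S) : survival P x (k + 1) s ≤ survival P x k s := by
  classical
  induction k generalizing s with
  | zero =>
    simp only [survival_succ, survival_zero]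
    calc _ ≤ ∑' t, P s t := ENNReal.tsum_le_tsum fun t => by split_ifs <;> simp
      _ = 1 := PMF.tsum_coe _
  | succ k ih =>
    rw [survival_succ, survival_succ P x k]
    refine ENNReal.tsum_le_tsum fun t => ?_
    gcongr
    split_ifs
    · exact le_rfl
    · exact ih t

lemma survival_antitone (x s : S) : Antitone fun k => survival P x k s :=
  antitone_nat_of_succ_le fun k => survival_succ_le x k s

/-- Olivier's theorem along the even numbers. -/
lemma tendsto_even_mul_zero_of_antitone {u : ℕ → ℝ≥0∞} (hu : Antitone u) (hs : ∑' k, u k ≠ ∞) :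
    Tendsto (fun n : ℕ => ((2 * n : ℕ) : ℝ≥0∞) * u (2 * n)) atTop (𝓝 0) := by
  have h0 : Tendsto (fun n => 2 * ∑' k, u (k + n)) atTop (𝓝 0) := by
    have := ENNReal.Tendsto.const_mul (a := 2) (ENNReal.tendsto_sum_nat_add u hs)
      (Or.inr (by simp))
    simpa using this
  refine tendsto_of_tendsto_of_tendsto_of_le_of_le tendsto_const_nhds h0 (fun _ => zero_le) ?_
  intro n
  have h1 : (n : ℝ≥0∞) * u (2 * n) ≤ ∑' k, u (k + n) := by
    calc (n : ℝ≥0∞) * u (2 * n) = ∑ k ∈ Finset.range n, u (2 * n) := by simp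
      _ ≤ ∑ k ∈ Finset.range n, u (k + n) :=
        Finset.sum_le_sum fun k hk => hu (by have := Finset.mem_range.mp hk; omega)
      _ ≤ _ := ENNReal.sum_le_tsum _
  simp only
  rw [Nat.cast_mul, mul_assoc]
  exact mul_le_mul' (by simp) h1

/-- A maximum principle: a probability `g` on `ℝ` with countable support which is unchanged by the
addition of an independent variable, with value `x i` with probability `p i`, forces this variable
to vanish. -/
lemma increment_eq_zero_of_convolution {ι : Type*} [Fintype ι] (p : ι → ℝ≥0∞)
    (hp : ∑ i, p i = 1) (x : ι → ℝ) (g : ℝ → ℝ≥0∞) (hg : ∑' r, g r = 1)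
    (hconv : ∀ r, g r = ∑ i, p i * g (r - x i)) (i : ι) (hi : p i ≠ 0) : x i = 0 := by
  classical
  have hfin : ∑' r, g r ≠ ∞ := by simp [hg]
  obtain ⟨r₀, hr₀⟩ : ∃ r, g r ≠ 0 := by
    by_contra! h
    simp [h] at hg
  -- A summable function attains its maximum.
  have hF : {r | g r₀ ≤ g r}.Finite := ENNReal.finite_const_le_of_tsum_ne_top hfin hr₀
  obtain ⟨m, hm, hmax⟩ := hF.exists_maximalFor g _ ⟨r₀, le_refl (g r₀)⟩
  have hmax' : ∀ r, g r ≤ g m := by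
    intro r
    rcases le_total (g r) (g m) with h | h
    · exact h
    · exact hmax (le_trans hm h) h
  have hm0 : g m ≠ 0 := fun h => hr₀ (by simpa [h] using hm)
  have hmt : g m ≠ ∞ := ne_top_of_le_ne_top hfin (ENNReal.le_tsum m)
  -- The set of maximizers is invariant under translation by `- x i`.
  have hinv : ∀ r, g r = g m → g (r - x i) = g m := by
    intro r hr
    by_contra hne
    have hlt : g (r - x i) < g m := lt_of_le_of_ne (hmax' _) hne
    have hpi : p i ≠ ∞ := by
      refine ne_top_of_le_ne_top (b := ∑ i, p i) (by simp [hp]) ?_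
      exact Finset.single_le_sum (f := p) (fun _ _ => zero_le) (Finset.mem_univ i)
    have : g m < g m := by
      calc g m = ∑ j, p j * g (r - x j) := by rw [← hr]; exact hconv r
        _ = p i * g (r - x i) + ∑ j ∈ Finset.univ.erase i, p j * g (r - x j) :=
          (Finset.add_sum_erase _ _ (Finset.mem_univ i)).symm
        _ < p i * g m + ∑ j ∈ Finset.univ.erase i, p j * g m := by
          refine ENNReal.add_lt_add_of_lt_of_le ?_ ?_ ?_
          · refine ne_top_of_le_ne_top (b := ∑ j, p j * g m) ?_ ?_
            · rw [← Finset.sum_mul, hp, one_mul]; exact hmt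
            · refine le_trans (Finset.sum_le_sum fun j _ =>
                mul_le_mul_right (hmax' _) _) ?_
              exact Finset.sum_le_sum_of_subset (Finset.erase_subset _ _)
          · exact ENNReal.mul_lt_mul_right hi hpi hlt
          · exact Finset.sum_le_sum fun j _ => mul_le_mul_right (hmax' _) _
        _ = ∑ j, p j * g m := Finset.add_sum_erase _ (fun j => p j * g m) (Finset.mem_univ i)
        _ = g m := by rw [← Finset.sum_mul, hp, one_mul]
    exact lt_irrefl _ this
  by_contra hx
  have hall : ∀ n : ℕ, g (m - n * x i) = g m := by
    intro n
    induction n with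
    | zero => simp
    | succ n ih =>
      have := hinv _ ih
      rw [← this]
      congr 1
      push_cast
      ring
  have hFm : {r | g m ≤ g r}.Finite := ENNReal.finite_const_le_of_tsum_ne_top hfin hm0
  have hinj : Function.Injective fun n : ℕ => m - n * x i := by
    intro a b hab
    have : (a : ℝ) * x i = b * x i := by simpa using hab
    exact_mod_cast mul_right_cancel₀ hx this
  exact Set.infinite_of_injective_forall_mem hinj (fun n => (hall n).ge) hFm

end MarkovChain

/-! ### Foster's criterion -/

namespace MarkovChain

variable {S : Type*}

open Classical in
/-- The law of the chain at time `k`, started from `x`. -/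
noncomputable def lawAt (P : S → PMF S) (x : S) : ℕ → S → ℝ≥0∞
  | 0, s => if s = x then 1 else 0
  | k + 1, t => ∑' s, lawAt P x k s * P s t

/-- The mean fraction of the times `0, …, n` which the chain, started from `x`, spends in `s`. -/
noncomputable def meanLaw (P : S → PMF S) (x : S) (n : ℕ) (s : S) : ℝ≥0∞ :=
  ((n + 1 : ℕ) : ℝ≥0∞)⁻¹ * ∑ k ∈ Finset.range (n + 1), lawAt P x k s

variable (P : S → PMF S) (x : S)

lemma tsum_lawAt (k : ℕ) : ∑' s, lawAt P x k s = 1 := by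
  classical
  induction k with
  | zero => simp [lawAt]
  | succ k ih =>
    have := tsum_mul_transition P (lawAt P x k) (fun _ => 1)
    simpa [lawAt, ih] using this

lemma lawAt_le_one (k : ℕ) (s : S) : lawAt P x k s ≤ 1 := by
  rw [← tsum_lawAt P x k]
  exact ENNReal.le_tsum s

lemma inv_mul_cast_succ (n : ℕ) : ((n + 1 : ℕ) : ℝ≥0∞)⁻¹ * ((n + 1 : ℕ) : ℝ≥0∞) = 1 :=
  ENNReal.inv_mul_cancel (by simp) (ENNReal.natCast_ne_top _)

lemma tsum_meanLaw_mul (n : ℕ) (h : S → ℝ≥0∞) :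
    ∑' s, meanLaw P x n s * h s = ((n + 1 : ℕ) : ℝ≥0∞)⁻¹ *
      ∑ k ∈ Finset.range (n + 1), ∑' s, lawAt P x k s * h s := by
  simp only [meanLaw, mul_assoc, Finset.sum_mul]
  rw [ENNReal.tsum_mul_left, Summable.tsum_finsetSum fun _ _ => ENNReal.summable]

lemma tsum_meanLaw (n : ℕ) : ∑' s, meanLaw P x n s = 1 := by
  have := tsum_meanLaw_mul P x n (fun _ => 1)
  simp only [mul_one, tsum_lawAt, Finset.sum_const, Finset.card_range, nsmul_eq_mul] at this
  rw [this, inv_mul_cast_succ]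

lemma tsum_meanLaw_mul_transition_le (n : ℕ) (t : S) :
    ∑' s, meanLaw P x n s * P s t ≤ meanLaw P x n t + ((n + 1 : ℕ) : ℝ≥0∞)⁻¹ := by
  rw [tsum_meanLaw_mul, meanLaw]
  calc ((n + 1 : ℕ) : ℝ≥0∞)⁻¹ * ∑ k ∈ Finset.range (n + 1), lawAt P x (k + 1) t
      ≤ ((n + 1 : ℕ) : ℝ≥0∞)⁻¹ * (∑ k ∈ Finset.range (n + 1), lawAt P x k t + 1) := by
        gcongr
        calc ∑ k ∈ Finset.range (n + 1), lawAt P x (k + 1) t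
            ≤ ∑ k ∈ Finset.range (n + 1), lawAt P x (k + 1) t + lawAt P x 0 t := le_self_add
          _ = ∑ k ∈ Finset.range (n + 1), lawAt P x k t + lawAt P x (n + 1) t := by
            rw [← Finset.sum_range_succ' (fun k => lawAt P x k t), Finset.sum_range_succ]
          _ ≤ _ := by gcongr; exact lawAt_le_one P x _ _
    _ = _ := by rw [mul_add, mul_one]

variable {P x}

lemma tsum_meanLaw_mul_le_of_drift {W q : S → ℝ≥0∞} {b : ℝ≥0∞}
    (hdrift : ∀ s, ∑' t, P s t * W t + q s ≤ W s + b) (n : ℕ) :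
    ∑' s, meanLaw P x n s * q s ≤ W x + b := by
  classical
  have hstep : ∀ k, ∑' s, lawAt P x (k + 1) s * W s + ∑' s, lawAt P x k s * q s
      ≤ ∑' s, lawAt P x k s * W s + b := by
    intro k
    have h1 : ∑' s, lawAt P x (k + 1) s * W s = ∑' s, lawAt P x k s * ∑' t, P s t * W t :=
      tsum_mul_transition P _ _
    rw [h1, ← ENNReal.tsum_add]
    calc _ ≤ ∑' s, (lawAt P x k s * W s + lawAt P x k s * b) := by
          refine ENNReal.tsum_le_tsum fun s => ?_
          rw [← mul_add, ← mul_add]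
          exact mul_le_mul_right (hdrift s) _
      _ = _ := by rw [ENNReal.tsum_add, ENNReal.tsum_mul_right, tsum_lawAt, one_mul]
  have hsum : ∀ n : ℕ, ∑' s, lawAt P x n s * W s
      + ∑ k ∈ Finset.range n, ∑' s, lawAt P x k s * q s ≤ W x + n * b := by
    intro n
    induction n with
    | zero => simp [lawAt]
    | succ n ih =>
      rw [Finset.sum_range_succ]
      calc _ = (∑' s, lawAt P x (n + 1) s * W s + ∑' s, lawAt P x n s * q s)
            + ∑ k ∈ Finset.range n, ∑' s, lawAt P x k s * q s := by ring
        _ ≤ (∑' s, lawAt P x n s * W s + b)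
            + ∑ k ∈ Finset.range n, ∑' s, lawAt P x k s * q s := add_le_add (hstep n) le_rfl
        _ = (∑' s, lawAt P x n s * W s
            + ∑ k ∈ Finset.range n, ∑' s, lawAt P x k s * q s) + b := by ring
        _ ≤ W x + n * b + b := by gcongr
        _ = _ := by push_cast; ring
  rw [tsum_meanLaw_mul]
  calc _ ≤ ((n + 1 : ℕ) : ℝ≥0∞)⁻¹ * (W x + ((n + 1 : ℕ) : ℝ≥0∞) * b) := by
        gcongr
        exact le_trans le_add_self (hsum (n + 1))
    _ = ((n + 1 : ℕ) : ℝ≥0∞)⁻¹ * W x + b := by rw [mul_add, ← mul_assoc, inv_mul_cast_succ, one_mul]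
    _ ≤ 1 * W x + b := by
      gcongr
      rw [ENNReal.inv_le_one]
      exact_mod_cast Nat.succ_pos n
    _ = _ := by rw [one_mul]

/-- Foster's criterion, by the Krylov–Bogoliubov method: if a Lyapunov function `W` decreases in mean
by at least `q - b` at each step, where `q` has finite sublevel sets, then the mean fractions of
time spent in the states are tight, and each of their limit points (here, along an ultrafilter) is
an invariant probability. -/
theorem exists_isInvariant_of_drift {W q : S → ℝ≥0∞} {b : ℝ≥0∞} (hb : b ≠ ∞)
    (hq : ∀ n : ℕ, {s | q s ≤ n}.Finite) (hW : W x ≠ ∞)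
    (hdrift : ∀ s, ∑' t, P s t * W t + q s ≤ W s + b) :
    ∃ π : S → ℝ≥0∞, IsInvariant P π ∧ ∑' s, π s = 1 := by
  classical
  let U : Ultrafilter ℕ := Ultrafilter.of atTop
  have hU : (U : Filter ℕ) ≤ atTop := Ultrafilter.of_le atTop
  have hlim : ∀ s, ∃ l, Tendsto (fun n => meanLaw P x n s) U (𝓝 l) := by
    intro s
    obtain ⟨l, -, hl⟩ := isCompact_univ.ultrafilter_le_nhds
      (U.map fun n => meanLaw P x n s) (by simp)
    exact ⟨l, hl⟩
  choose π hπ using hlim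
  have hfin : ∀ F : Finset S, Tendsto (fun n => ∑ s ∈ F, meanLaw P x n s) U (𝓝 (∑ s ∈ F, π s)) :=
    fun F => tendsto_finsetSum F fun s _ => hπ s
  have hle : ∑' s, π s ≤ 1 := by
    rw [ENNReal.tsum_eq_iSup_sum]
    refine iSup_le fun F => le_of_tendsto (hfin F) (Eventually.of_forall fun n => ?_)
    rw [← tsum_meanLaw P x n]
    exact ENNReal.sum_le_tsum F
  have htight : ∀ K : ℕ, (K : ℝ≥0∞) ≤ K * ∑' s, π s + (W x + b) := by
    intro K
    have h1 : ∀ n, (K : ℝ≥0∞) ≤ K * ∑ s ∈ (hq K).toFinset, meanLaw P x n s + (W x + b) := by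
      intro n
      calc (K : ℝ≥0∞) = ∑' s, meanLaw P x n s * K := by
            rw [ENNReal.tsum_mul_right, tsum_meanLaw, one_mul]
        _ ≤ ∑' s, (K * (if s ∈ (hq K).toFinset then meanLaw P x n s else 0)
              + meanLaw P x n s * q s) := by
          refine ENNReal.tsum_le_tsum fun s => ?_
          by_cases h : q s ≤ K
          · simp [h, mul_comm]
          · refine le_trans ?_ le_add_self
            gcongr
            exact (not_le.mp h).le
        _ = K * (∑' s, if s ∈ (hq K).toFinset then meanLaw P x n s else 0)
              + ∑' s, meanLaw P x n s * q s := by rw [ENNReal.tsum_add, ENNReal.tsum_mul_left]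
        _ ≤ _ := by
          rw [tsum_eq_sum (s := (hq K).toFinset) fun s hs => if_neg hs, Finset.sum_ite_mem,
            Finset.inter_self]
          exact add_le_add le_rfl (tsum_meanLaw_mul_le_of_drift hdrift n)
    have h2 : Tendsto (fun n => (K : ℝ≥0∞) * ∑ s ∈ (hq K).toFinset, meanLaw P x n s + (W x + b)) U
        (𝓝 (K * ∑ s ∈ (hq K).toFinset, π s + (W x + b))) :=
      (ENNReal.Tendsto.const_mul (hfin _) (Or.inr (by simp))).add tendsto_const_nhds
    refine le_trans (ge_of_tendsto h2 (Eventually.of_forall h1)) ?_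
    gcongr
    exact ENNReal.sum_le_tsum _
  have hone : ∑' s, π s = 1 := by
    refine le_antisymm hle ?_
    by_contra hlt
    rw [not_le] at hlt
    have hC : W x + b ≠ ∞ := ENNReal.add_ne_top.mpr ⟨hW, hb⟩
    lift (W x + b) to NNReal using hC with C
    lift (∑' s, π s) to NNReal using hlt.ne_top with a
    have ha : (a : ℝ) < 1 := by exact_mod_cast hlt
    obtain ⟨K, hK⟩ := exists_nat_gt ((C : ℝ) / (1 - a))
    have h1 : (K : ℝ) ≤ K * a + C := by exact_mod_cast htight K
    rw [div_lt_iff₀ (by linarith)] at hK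
    linarith
  have hsub : ∀ t, ∑' s, π s * P s t ≤ π t := by
    intro t
    rw [ENNReal.tsum_eq_iSup_sum]
    refine iSup_le fun F => ?_
    have h1 : Tendsto (fun n => ∑ s ∈ F, meanLaw P x n s * P s t) U
        (𝓝 (∑ s ∈ F, π s * P s t)) :=
      tendsto_finsetSum F fun s _ =>
        ENNReal.Tendsto.mul_const (hπ s) (Or.inr (PMF.apply_ne_top _ _))
    have h2 : Tendsto (fun n : ℕ => meanLaw P x n t + ((n + 1 : ℕ) : ℝ≥0∞)⁻¹) U (𝓝 (π t + 0)) := by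
      refine (hπ t).add (Tendsto.mono_left ?_ hU)
      exact (tendsto_add_atTop_iff_nat 1).mpr ENNReal.tendsto_inv_nat_nhds_zero
    rw [add_zero] at h2
    refine le_of_tendsto_of_tendsto' h1 h2 fun n => ?_
    exact le_trans (ENNReal.sum_le_tsum F) (tsum_meanLaw_mul_transition_le P x n t)
  refine ⟨π, fun t => ?_, hone⟩
  -- Both sides have total mass one.
  refine le_antisymm (hsub t) (le_of_not_gt fun hlt => ?_)
  have h1 : ∑' u, ∑' s, π s * P s u = 1 := by
    have := tsum_mul_transition P π (fun _ => 1)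
    simpa [hone] using this
  have h2 := ENNReal.tsum_lt_tsum (by rw [h1]; simp) hsub hlt
  rw [h1, hone] at h2
  exact lt_irrefl _ h2

end MarkovChain

/-! ### Trajectories and the Markov property -/

namespace MarkovChain

variable {S A : Type*}

/-- The sequence `a, ω 0, ω 1, …`. -/
def cons (a : A) (ω : ℕ → A) : ℕ → A
  | 0 => a
  | n + 1 => ω n

/-- The sequence `ω n, ω (n + 1), …`. -/
def shift (n : ℕ) (ω : ℕ → A) : ℕ → A := fun k => ω (k + n)

@[simp] lemma cons_zero (a : A) (ω : ℕ → A) : cons a ω 0 = a := rfl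

@[simp] lemma cons_succ (a : A) (ω : ℕ → A) (n : ℕ) : cons a ω (n + 1) = ω n := rfl

lemma shift_shift (m n : ℕ) (ω : ℕ → A) : shift m (shift n ω) = shift (n + m) ω := by
  funext k
  simp only [shift]
  congr 1
  omega

lemma tsum_map_mul (q : PMF A) (f : A → S) (h : S → ℝ≥0∞) :
    ∑' t, (q.map f) t * h t = ∑' a, q a * h (f a) := by
  classical
  simp only [PMF.map_apply, ← ENNReal.tsum_mul_right]
  rw [ENNReal.tsum_comm]
  refine tsum_congr fun a => ?_
  rw [tsum_eq_single (f a)]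
  · simp
  · intro t ht
    simp [ht]

section Measurable

variable [MeasurableSpace A]

lemma measurable_cons (a : A) : Measurable (cons a) := by
  refine measurable_pi_iff.mpr fun n => ?_
  cases n with
  | zero => exact measurable_const
  | succ n => exact measurable_pi_apply n

lemma measurable_shift (n : ℕ) : Measurable (shift n : (ℕ → A) → ℕ → A) :=
  measurable_pi_iff.mpr fun k => measurable_pi_apply (k + n)

/-- `Q s` is the law of the trajectory of random steps, where the first step has law `p s` and the
steps after a step `a` form a trajectory with law `Q (next a)`. -/
structure IsTrajectoryLaw (next : A → S) (p : S → PMF A) (Q : S → Measure (ℕ → A)) : Prop where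
  isProbabilityMeasure : ∀ s, IsProbabilityMeasure (Q s)
  lintegral_eq : ∀ s (F : (ℕ → A) → ℝ≥0∞), Measurable F →
    ∫⁻ ω, F ω ∂Q s = ∑' a, p s a * ∫⁻ ω, F (cons a ω) ∂Q (next a)

variable {next : A → S} {p : S → PMF A} {Q : S → Measure (ℕ → A)}

lemma IsTrajectoryLaw.measure_eq (h : IsTrajectoryLaw next p Q) (s : S) {E : Set (ℕ → A)}
    (hE : MeasurableSet E) : Q s E = ∑' a, p s a * Q (next a) (cons a ⁻¹' E) := by
  rw [← lintegral_indicator_one hE, h.lintegral_eq s _ (measurable_one.indicator hE)]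
  refine tsum_congr fun a => ?_
  rw [← lintegral_indicator_one (measurable_cons a hE)]
  rfl

/-- The Markov property for an event which is determined by the steps `0, …, n` and on which the
last one of them leads to `x`. -/
lemma IsTrajectoryLaw.measure_inter_shift (h : IsTrajectoryLaw next p Q) {x : S}
    {B : Set (ℕ → A)} (hB : MeasurableSet B) (n : ℕ) (s : S) {E : Set (ℕ → A)}
    (hE : MeasurableSet E) (hdep : ∀ ω ω', (∀ k ≤ n, ω k = ω' k) → ω ∈ E → ω' ∈ E)
    (hx : ∀ ω ∈ E, next (ω n) = x) :
    Q s (E ∩ shift (n + 1) ⁻¹' B) = Q s E * Q x B := by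
  have := h.isProbabilityMeasure
  induction n generalizing s E with
  | zero =>
    rw [h.measure_eq s (hE.inter (measurable_shift _ hB)), h.measure_eq s hE,
      ← ENNReal.tsum_mul_right]
    refine tsum_congr fun a => ?_
    rw [mul_assoc]
    congr 1
    by_cases hne : (cons a ⁻¹' E).Nonempty
    · obtain ⟨ω, hω⟩ := hne
      have huniv : cons a ⁻¹' E = Set.univ := by
        refine Set.eq_univ_of_forall fun ω' => hdep (cons a ω) _ (fun k hk => ?_) hω
        obtain rfl : k = 0 := by omega
        rfl
      have hax : next a = x := hx _ hω
      have hsh : cons a ⁻¹' (shift (0 + 1) ⁻¹' B) = B := rfl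
      rw [Set.preimage_inter, hsh, huniv, Set.univ_inter, measure_univ, one_mul, hax]
    · rw [Set.not_nonempty_iff_eq_empty] at hne
      rw [Set.preimage_inter, hne]
      simp
  | succ n ih =>
    rw [h.measure_eq s (hE.inter (measurable_shift _ hB)), h.measure_eq s hE,
      ← ENNReal.tsum_mul_right]
    refine tsum_congr fun a => ?_
    rw [mul_assoc]
    congr 1
    refine ih (next a) (E := cons a ⁻¹' E) (measurable_cons a hE) ?_ fun ω hω => hx _ hω
    intro ω ω' hk hω
    refine hdep (cons a ω) (cons a ω') (fun k hk' => ?_) hω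
    cases k with
    | zero => rfl
    | succ k => exact hk k (by omega)

variable [DiscreteMeasurableSpace A]

lemma measurableSet_avoid (next : A → S) (x : S) (k : ℕ) :
    MeasurableSet {ω : ℕ → A | ∀ t < k, next (ω t) ≠ x} := by
  have : {ω : ℕ → A | ∀ t < k, next (ω t) ≠ x}
      = ⋂ t, ⋂ (_ : t < k), (fun ω : ℕ → A => ω t) ⁻¹' {a | next a ≠ x} := by
    ext ω; simp
  rw [this]
  exact MeasurableSet.iInter fun t => MeasurableSet.iInter fun _ =>
    measurable_pi_apply t (MeasurableSet.of_discrete)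

open Classical in
lemma IsTrajectoryLaw.lintegral_avoid (h : IsTrajectoryLaw next p Q) (x : S) (g : A → ℝ≥0∞)
    (k : ℕ) (s : S) :
    ∫⁻ ω, (if ∀ t < k, next (ω t) ≠ x then g (ω k) else 0) ∂Q s
      = killed (fun s => (p s).map next) x (fun s => ∑' a, p s a * g a) k s := by
  have := h.isProbabilityMeasure
  have hg : ∀ k : ℕ, Measurable fun ω : ℕ → A => g (ω k) := fun k =>
    (Measurable.of_discrete (f := g)).comp (measurable_pi_apply k)
  induction k generalizing s with
  | zero =>
    rw [h.lintegral_eq s _ (Measurable.ite (measurableSet_avoid next x 0) (hg 0) measurable_const)]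
    simp [killed]
  | succ k ih =>
    rw [h.lintegral_eq s _
      (Measurable.ite (measurableSet_avoid next x (k + 1)) (hg _) measurable_const)]
    rw [killed, tsum_map_mul]
    refine tsum_congr fun a => ?_
    congr 1
    have hiff : ∀ ω : ℕ → A, (∀ t < k + 1, next (cons a ω t) ≠ x) ↔
        next a ≠ x ∧ ∀ t < k, next (ω t) ≠ x := by
      intro ω
      constructor
      · exact fun H => ⟨H 0 (by omega), fun t ht => H (t + 1) (by omega)⟩
      · rintro ⟨h0, H⟩ (_ | t) ht
        · exact h0
        · exact H t (by omega)
    simp only [hiff, cons_succ]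
    by_cases hax : next a = x
    · simp [hax]
    · simp only [hax, ne_eq, not_false_eq_true, true_and, if_false]
      exact ih (next a)

lemma IsTrajectoryLaw.measure_avoid (h : IsTrajectoryLaw next p Q) (x : S) (k : ℕ) (s : S) :
    Q s {ω | ∀ t < k, next (ω t) ≠ x} = survival (fun s => (p s).map next) x k s := by
  classical
  have := h.lintegral_avoid x (fun _ => 1) k s
  simp only [mul_one, PMF.tsum_coe] at this
  rw [survival, ← this, ← lintegral_indicator_one (measurableSet_avoid next x k)]
  refine lintegral_congr fun ω => ?_
  simp [Set.indicator_apply]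

/-- The sum of a function of the steps over an excursion from `x`. -/
lemma IsTrajectoryLaw.lintegral_tsum_avoid [Countable A] (h : IsTrajectoryLaw next p Q) (x : S)
    (g : A → ℝ≥0∞) :
    open Classical in
    ∫⁻ ω, ∑' k, (if ∀ t < k, next (ω t) ≠ x then g (ω k) else 0) ∂Q x
      = ∑' s, occupation (fun s => (p s).map next) x s * ∑' a, p s a * g a := by
  classical
  have hg : ∀ k : ℕ, Measurable fun ω : ℕ → A => g (ω k) := fun k =>
    (Measurable.of_discrete (f := g)).comp (measurable_pi_apply k)
  rw [lintegral_tsum fun k => (Measurable.ite (measurableSet_avoid next x k) (hg _)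
    measurable_const).aemeasurable, tsum_occupation_mul]
  exact tsum_congr fun k => by rw [← h.lintegral_avoid]

end Measurable

end MarkovChain

/-! ### Excursions and the strong law of large numbers -/

namespace MarkovChain

variable {S A : Type*}

/-- The number of steps before the one which first leads to `x`. It is `0` if there is no such
step. -/
noncomputable def returnIndex (next : A → S) (x : S) (ω : ℕ → A) : ℕ :=
  sInf {t | next (ω t) = x}

/-- The trajectory after the first step which leads to `x`. -/
noncomputable def afterReturn (next : A → S) (x : S) (ω : ℕ → A) : ℕ → A :=
  shift (returnIndex next x ω + 1) ω

/-- The sum of `g` over the steps up to the first one which leads to `x`. -/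
noncomputable def excursionSum (next : A → S) (x : S) (g : A → NNReal) (ω : ℕ → A) : ℝ :=
  ∑ k ∈ Finset.range (returnIndex next x ω + 1), (g (ω k) : ℝ)

lemma excursionSum_nonneg (next : A → S) (x : S) (g : A → NNReal) (ω : ℕ → A) :
    0 ≤ excursionSum next x g ω := Finset.sum_nonneg fun _ _ => NNReal.coe_nonneg _

/-- The number of steps up to the `n`-th one which leads to `x`. -/
noncomputable def returnTime (next : A → S) (x : S) (n : ℕ) (ω : ℕ → A) : ℕ :=
  ∑ k ∈ Finset.range n, (returnIndex next x ((afterReturn next x)^[k] ω) + 1)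

lemma iterate_afterReturn (next : A → S) (x : S) (n : ℕ) (ω : ℕ → A) :
    (afterReturn next x)^[n] ω = shift (returnTime next x n ω) ω := by
  induction n with
  | zero => rfl
  | succ n ih =>
    rw [Function.iterate_succ_apply', returnTime, Finset.sum_range_succ]
    conv_lhs => rw [afterReturn]
    nth_rewrite 2 [ih]
    rw [shift_shift]
    rfl

lemma sum_excursionSum (next : A → S) (x : S) (g : A → NNReal) (n : ℕ) (ω : ℕ → A) :
    ∑ k ∈ Finset.range n, excursionSum next x g ((afterReturn next x)^[k] ω)
      = ∑ u ∈ Finset.range (returnTime next x n ω), (g (ω u) : ℝ) := by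
  induction n with
  | zero => simp [returnTime]
  | succ n ih =>
    have h : returnTime next x (n + 1) ω = returnTime next x n ω
        + (returnIndex next x ((afterReturn next x)^[n] ω) + 1) := Finset.sum_range_succ _ _
    rw [Finset.sum_range_succ, ih, h, Finset.sum_range_add]
    congr 1
    rw [excursionSum]
    refine Finset.sum_congr rfl fun k _ => ?_
    rw [iterate_afterReturn, shift, add_comm k]

/-- The step `n` is the first one which leads to `x`. -/
def firstReturn (next : A → S) (x : S) (n : ℕ) : Set (ℕ → A) :=
  {ω | next (ω n) = x ∧ ∀ t < n, next (ω t) ≠ x}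

lemma returnIndex_eq {next : A → S} {x : S} {n : ℕ} {ω : ℕ → A}
    (h : ω ∈ firstReturn next x n) : returnIndex next x ω = n := by
  refine le_antisymm (Nat.sInf_le h.1) (le_csInf ⟨n, h.1⟩ fun t ht => ?_)
  by_contra hlt
  exact h.2 t (not_le.mp hlt) ht

lemma mem_firstReturn {next : A → S} {x : S} {ω : ℕ → A} (h : ∃ t, next (ω t) = x) :
    ω ∈ firstReturn next x (returnIndex next x ω) :=
  ⟨Nat.sInf_mem h, fun _ ht => Nat.notMem_of_lt_sInf ht⟩

lemma disjoint_firstReturn (next : A → S) (x : S) :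
    Pairwise (Function.onFun Disjoint (firstReturn next x)) := by
  intro m n hmn
  refine Set.disjoint_left.mpr fun ω hm hn => hmn ?_
  rw [← returnIndex_eq hm, returnIndex_eq hn]

open Classical in
lemma tsum_avoid_eq {next : A → S} {x : S} {ω : ℕ → A} (hω : ∃ t, next (ω t) = x) (g : A → NNReal) :
    ∑' k, (if ∀ t < k, next (ω t) ≠ x then (g (ω k) : ℝ≥0∞) else 0)
      = ENNReal.ofReal (excursionSum next x g ω) := by
  have h := mem_firstReturn hω
  rw [tsum_eq_sum (s := Finset.range (returnIndex next x ω + 1)), excursionSum,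
    ENNReal.ofReal_sum_of_nonneg fun _ _ => NNReal.coe_nonneg _]
  · refine Finset.sum_congr rfl fun k hk => ?_
    rw [if_pos, ENNReal.ofReal_coe_nnreal]
    intro t ht
    exact h.2 t (by have := Finset.mem_range.mp hk; omega)
  · intro k hk
    rw [if_neg]
    intro H
    exact H _ (by have := Finset.mem_range.not.mp hk; omega) h.1

section Measurable

variable [MeasurableSpace A] [DiscreteMeasurableSpace A]

lemma measurableSet_firstReturn (next : A → S) (x : S) (n : ℕ) :
    MeasurableSet (firstReturn next x n) :=
  MeasurableSet.inter
    (measurable_pi_apply (X := fun _ : ℕ => A) n (MeasurableSet.of_discrete (s := {a | next a = x})))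
    (measurableSet_avoid next x n)

lemma measurable_returnIndex (next : A → S) (x : S) : Measurable (returnIndex next x) := by
  refine measurable_to_countable' fun n => ?_
  have h : returnIndex next x ⁻¹' {n} = firstReturn next x n ∪
      (if n = 0 then (⋃ k, firstReturn next x k)ᶜ else ∅) := by
    ext ω
    simp only [Set.mem_preimage, Set.mem_singleton_iff, Set.mem_union]
    by_cases hω : ∃ t, next (ω t) = x
    · have hmem : ω ∈ ⋃ k, firstReturn next x k := Set.mem_iUnion.mpr ⟨_, mem_firstReturn hω⟩
      constructor
      · rintro rfl; exact Or.inl (mem_firstReturn hω)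
      · rintro (h | h)
        · exact returnIndex_eq h
        · split_ifs at h
          · exact absurd hmem h
          · exact absurd h (by simp)
    · have h0 : returnIndex next x ω = 0 := by
        have : {t | next (ω t) = x} = ∅ := by
          ext t; simpa using fun h => hω ⟨t, h⟩
        rw [returnIndex, this, Nat.sInf_empty]
      have hno : ∀ k, ω ∉ firstReturn next x k := fun k hk => hω ⟨k, hk.1⟩
      rw [h0]
      constructor
      · rintro rfl; exact Or.inr (by simpa using hno)
      · rintro (h | h)
        · exact absurd h (hno n)
        · split_ifs at h with hn
          · exact hn.symm
          · exact absurd h (by simp)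
  rw [h]
  refine (measurableSet_firstReturn next x n).union ?_
  split_ifs
  · exact (MeasurableSet.iUnion fun k => measurableSet_firstReturn next x k).compl
  · exact MeasurableSet.empty

lemma measurable_comp_returnIndex {next : A → S} {x : S} {β : Type*} [MeasurableSpace β]
    {F : ℕ → (ℕ → A) → β} (hF : ∀ n, Measurable (F n)) :
    Measurable fun ω => F (returnIndex next x ω) ω := by
  have h : Measurable fun q : ℕ × (ℕ → A) => F q.1 q.2 := measurable_from_prod_countable_right hF
  exact h.comp ((measurable_returnIndex next x).prodMk measurable_id)

lemma measurable_afterReturn (next : A → S) (x : S) : Measurable (afterReturn next x) :=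
  measurable_comp_returnIndex fun n => measurable_shift (n + 1)

lemma measurable_excursionSum (next : A → S) (x : S) (g : A → NNReal) :
    Measurable (excursionSum next x g) := by
  refine measurable_comp_returnIndex
    (F := fun n ω => ∑ k ∈ Finset.range (n + 1), (g (ω k) : ℝ)) fun n => ?_
  exact Finset.measurable_sum _ fun k _ =>
    (Measurable.of_discrete (f := fun a => (g a : ℝ))).comp (measurable_pi_apply k)

variable {next : A → S} {p : S → PMF A} {Q : S → Measure (ℕ → A)} {x : S}

lemma IsTrajectoryLaw.ae_returns (h : IsTrajectoryLaw next p Q)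
    (hx : ∑' k, survival (fun s => (p s).map next) x k x ≠ ∞) :
    ∀ᵐ ω ∂Q x, ∃ t, next (ω t) = x := by
  rw [ae_iff]
  have hle : ∀ k, Q x {ω | ¬ ∃ t, next (ω t) = x} ≤ survival (fun s => (p s).map next) x k x := by
    intro k
    rw [← h.measure_avoid]
    refine measure_mono fun ω hω t _ ht => hω ⟨t, ht⟩
  have h0 := ENNReal.tendsto_atTop_zero_of_tsum_ne_top hx
  exact le_antisymm (ge_of_tendsto' h0 hle) zero_le

/-- The regeneration property: the trajectory after the first return to `x` is independent of the
excursion before it, and it has the original law. -/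
lemma IsTrajectoryLaw.measure_regeneration (h : IsTrajectoryLaw next p Q)
    (hx : ∑' k, survival (fun s => (p s).map next) x k x ≠ ∞) (g : A → NNReal) {C : Set ℝ}
    (hC : MeasurableSet C) {B : Set (ℕ → A)} (hB : MeasurableSet B) :
    Q x (excursionSum next x g ⁻¹' C ∩ afterReturn next x ⁻¹' B)
      = Q x (excursionSum next x g ⁻¹' C) * Q x B := by
  have hcover : ∀ E : Set (ℕ → A), MeasurableSet E →
      Q x E = ∑' n, Q x (E ∩ firstReturn next x n) := by
    intro E hE
    rw [← measure_iUnion, ← Set.inter_iUnion]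
    · refine (measure_inter_conull ?_).symm
      refine measure_mono_null (fun ω hω => ?_) (ae_iff.mp (h.ae_returns hx))
      intro hex
      exact hω (Set.mem_iUnion.mpr ⟨_, mem_firstReturn hex⟩)
    · exact fun m n hmn => ((disjoint_firstReturn next x) hmn).mono Set.inter_subset_right
        Set.inter_subset_right
    · exact fun n => hE.inter (measurableSet_firstReturn next x n)
  have hCm := measurable_excursionSum next x g hC
  rw [hcover _ (hCm.inter (measurable_afterReturn next x hB)), hcover _ hCm,
    ← ENNReal.tsum_mul_right]
  refine tsum_congr fun n => ?_
  rw [← h.measure_inter_shift hB n x (hCm.inter (measurableSet_firstReturn next x n)) ?_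
    fun ω hω => hω.2.1]
  · congr 1
    ext ω
    simp only [Set.mem_inter_iff, Set.mem_preimage]
    constructor
    · rintro ⟨⟨h1, h2⟩, h3⟩
      refine ⟨⟨h1, h3⟩, ?_⟩
      rwa [afterReturn, returnIndex_eq h3] at h2
    · rintro ⟨⟨h1, h3⟩, h2⟩
      refine ⟨⟨h1, ?_⟩, h3⟩
      rwa [afterReturn, returnIndex_eq h3]
  · rintro ω ω' hk ⟨h1, h2⟩
    have h2' : ω' ∈ firstReturn next x n := by
      refine ⟨?_, fun t ht => ?_⟩
      · rw [← hk n le_rfl]; exact h2.1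
      · rw [← hk t ht.le]; exact h2.2 t ht
    refine ⟨?_, h2'⟩
    rw [Set.mem_preimage, excursionSum, returnIndex_eq h2] at h1
    rw [Set.mem_preimage, excursionSum, returnIndex_eq h2']
    convert h1 using 1
    refine Finset.sum_congr rfl fun k hk' => ?_
    rw [hk k (by have := Finset.mem_range.mp hk'; omega)]

lemma IsTrajectoryLaw.measurePreserving_afterReturn (h : IsTrajectoryLaw next p Q)
    (hx : ∑' k, survival (fun s => (p s).map next) x k x ≠ ∞) :
    MeasurePreserving (afterReturn next x) (Q x) (Q x) := by
  have := h.isProbabilityMeasure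
  refine ⟨measurable_afterReturn next x, Measure.ext fun B hB => ?_⟩
  rw [Measure.map_apply (measurable_afterReturn next x) hB]
  have := h.measure_regeneration hx (fun _ => 0) MeasurableSet.univ hB
  simpa using this

/-- The sums over the successive excursions from `x` are pairwise independent: by invariance under
`afterReturn`, it suffices to compare the first excursion with a later one. -/
lemma IsTrajectoryLaw.indepFun_excursionSum (h : IsTrajectoryLaw next p Q)
    (hx : ∑' k, survival (fun s => (p s).map next) x k x ≠ ∞) (g : A → NNReal) :
    Pairwise (Function.onFun (fun X Y => IndepFun X Y (Q x))
      fun k ω => excursionSum next x g ((afterReturn next x)^[k] ω)) := by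
  have hR := h.measurePreserving_afterReturn hx
  have hX := measurable_excursionSum next x g
  have hlt : ∀ j m, IndepFun (fun ω => excursionSum next x g ((afterReturn next x)^[j] ω))
      (fun ω => excursionSum next x g ((afterReturn next x)^[m + 1 + j] ω)) (Q x) := by
    intro j m
    rw [indepFun_iff_measure_inter_preimage_eq_mul]
    intro C D hC hD
    have hY : MeasurableSet
        ((fun ω => excursionSum next x g ((afterReturn next x)^[m] ω)) ⁻¹' D) :=
      (hX.comp (hR.iterate m).measurable) hD
    have hY' : MeasurableSet (afterReturn next x ⁻¹'
        ((fun ω => excursionSum next x g ((afterReturn next x)^[m] ω)) ⁻¹' D)) :=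
      hR.measurable hY
    have e1 : (fun ω => excursionSum next x g ((afterReturn next x)^[j] ω)) ⁻¹' C
        = (afterReturn next x)^[j] ⁻¹' (excursionSum next x g ⁻¹' C) := rfl
    have e2 : (fun ω => excursionSum next x g ((afterReturn next x)^[m + 1 + j] ω)) ⁻¹' D
        = (afterReturn next x)^[j] ⁻¹' (afterReturn next x ⁻¹'
          ((fun ω => excursionSum next x g ((afterReturn next x)^[m] ω)) ⁻¹' D)) := by
      ext ω
      simp only [Set.mem_preimage, Function.iterate_add_apply, Function.iterate_one]
    rw [e1, e2, ← Set.preimage_inter,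
      (hR.iterate j).measure_preimage ((hX hC).inter hY').nullMeasurableSet,
      (hR.iterate j).measure_preimage (hX hC).nullMeasurableSet,
      (hR.iterate j).measure_preimage hY'.nullMeasurableSet,
      hR.measure_preimage hY.nullMeasurableSet]
    exact h.measure_regeneration hx g hC hY
  intro j k hjk
  rcases lt_or_gt_of_ne hjk with hlt' | hlt'
  · obtain ⟨m, rfl⟩ := Nat.exists_eq_add_of_lt hlt'
    have := hlt j m
    rwa [show m + 1 + j = j + m + 1 by omega] at this
  · obtain ⟨m, rfl⟩ := Nat.exists_eq_add_of_lt hlt'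
    have := hlt k m
    rw [show m + 1 + k = k + m + 1 by omega] at this
    exact this.symm

lemma IsTrajectoryLaw.lintegral_excursionSum [Countable A] (h : IsTrajectoryLaw next p Q)
    (hx : ∑' k, survival (fun s => (p s).map next) x k x ≠ ∞) (g : A → NNReal) :
    ∫⁻ ω, ENNReal.ofReal (excursionSum next x g ω) ∂Q x
      = ∑' s, occupation (fun s => (p s).map next) x s * ∑' a, p s a * g a := by
  classical
  rw [← h.lintegral_tsum_avoid]
  refine lintegral_congr_ae ?_
  filter_upwards [h.ae_returns hx] with ω hω
  rw [← tsum_avoid_eq hω]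

/-- The strong law of large numbers for the sums over the excursions from `x`. -/
lemma IsTrajectoryLaw.tendsto_sum_returnTime [Countable A] (h : IsTrajectoryLaw next p Q)
    (hx : ∑' k, survival (fun s => (p s).map next) x k x ≠ ∞) (g : A → NNReal)
    (hg : ∀ a, g a ≤ 1) :
    ∀ᵐ ω ∂Q x, Tendsto (fun n : ℕ =>
        (∑ u ∈ Finset.range (returnTime next x n ω), (g (ω u) : ℝ)) / n) atTop
      (𝓝 (∑' s, occupation (fun s => (p s).map next) x s * ∑' a, p s a * g a).toReal) := by
  have := h.isProbabilityMeasure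
  have hR := h.measurePreserving_afterReturn hx
  have hX := measurable_excursionSum next x g
  have hle : ∑' s, occupation (fun s => (p s).map next) x s * ∑' a, p s a * g a ≠ ∞ := by
    refine ne_top_of_le_ne_top hx ?_
    rw [← tsum_occupation]
    refine ENNReal.tsum_le_tsum fun s => mul_le_of_le_one_right zero_le ?_
    rw [← (p s).tsum_coe]
    exact ENNReal.tsum_le_tsum fun a => mul_le_of_le_one_right zero_le (by exact_mod_cast hg a)
  have hmean := h.lintegral_excursionSum hx g
  have hint : Integrable (excursionSum next x g) (Q x) := by
    refine ⟨hX.aestronglyMeasurable, ?_⟩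
    rw [hasFiniteIntegral_iff_ofReal (Eventually.of_forall (excursionSum_nonneg next x g)), hmean]
    exact hle.lt_top
  have hlln := strong_law_ae_real
    (fun k ω => excursionSum next x g ((afterReturn next x)^[k] ω)) hint
    (h.indepFun_excursionSum hx g) (fun k => by
      refine ⟨(hX.comp (hR.iterate k).measurable).aemeasurable, hX.aemeasurable, ?_⟩
      rw [Function.iterate_zero]
      change Measure.map (excursionSum next x g ∘ (afterReturn next x)^[k]) (Q x) = _
      rw [← Measure.map_map hX (hR.iterate k).measurable, (hR.iterate k).map_eq]
      rfl)
  filter_upwards [hlln] with ω hω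
  simp only [sum_excursionSum] at hω
  convert hω using 2
  simp only [Function.iterate_zero, id_eq]
  rw [integral_eq_lintegral_of_nonneg_ae (Eventually.of_forall (excursionSum_nonneg next x g))
    hX.aestronglyMeasurable, hmean]

end Measurable

/-- From limits along a sequence of times with a positive density to limits along all times. -/
lemma tendsto_div_of_tendsto_subseq {N : ℕ → ℝ} (hN : Monotone N) (hN0 : ∀ t, 0 ≤ N t)
    {τ : ℕ → ℕ} (hτ : StrictMono τ) (hτ0 : τ 0 = 0) {a b : ℝ} (ha : 0 < a)
    (h1 : Tendsto (fun n : ℕ => (τ n : ℝ) / n) atTop (𝓝 a))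
    (h2 : Tendsto (fun n : ℕ => N (τ n) / n) atTop (𝓝 b)) :
    Tendsto (fun t : ℕ => N t / t) atTop (𝓝 (b / a)) := by
  -- `m t` is the number of completed cycles at time `t`.
  let m : ℕ → ℕ := fun t => Nat.findGreatest (fun n => τ n ≤ t) t
  have hm1 : ∀ t, τ (m t) ≤ t := fun t =>
    Nat.findGreatest_spec (P := fun n => τ n ≤ t) (Nat.zero_le t) (by simp [hτ0])
  have hm2 : ∀ t, t < τ (m t + 1) := by
    intro t
    by_contra hle
    rw [not_lt] at hle
    have h3 : m t + 1 ≤ t := le_trans (hτ.id_le _) hle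
    have := Nat.le_findGreatest (P := fun n => τ n ≤ t) h3 hle
    exact absurd this (by simp only [m]; omega)
  have hm : Tendsto m atTop atTop := by
    refine tendsto_atTop.mpr fun n => ?_
    filter_upwards [eventually_ge_atTop (τ n)] with t ht
    by_contra hlt
    rw [not_le] at hlt
    exact absurd (hm2 t) (not_lt.mpr (le_trans (hτ.monotone hlt) ht))
  have hs : Tendsto (fun n : ℕ => ((n : ℝ) + 1) / n) atTop (𝓝 1) := by
    have : Tendsto (fun n : ℕ => 1 + 1 / (n : ℝ)) atTop (𝓝 (1 + 0)) :=
      tendsto_const_nhds.add tendsto_one_div_atTop_nhds_zero_nat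
    rw [add_zero] at this
    refine this.congr' ?_
    filter_upwards [eventually_gt_atTop 0] with n hn
    have : (n : ℝ) ≠ 0 := by positivity
    field_simp
  have h1' : Tendsto (fun n : ℕ => (τ (n + 1) : ℝ) / n) atTop (𝓝 a) := by
    have := ((tendsto_add_atTop_iff_nat 1).mpr h1).mul hs
    rw [mul_one] at this
    refine this.congr' ?_
    filter_upwards [eventually_gt_atTop 0] with n hn
    have : (n : ℝ) ≠ 0 := by positivity
    push_cast
    field_simp
  have h2' : Tendsto (fun n : ℕ => N (τ (n + 1)) / n) atTop (𝓝 b) := by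
    have := ((tendsto_add_atTop_iff_nat 1).mpr h2).mul hs
    rw [mul_one] at this
    refine this.congr' ?_
    filter_upwards [eventually_gt_atTop 0] with n hn
    have : (n : ℝ) ≠ 0 := by positivity
    push_cast
    field_simp
  have hlow : Tendsto (fun n : ℕ => N (τ n) / τ (n + 1)) atTop (𝓝 (b / a)) := by
    refine (h2.div h1' ha.ne').congr' ?_
    filter_upwards [eventually_gt_atTop 0] with n hn
    have : (n : ℝ) ≠ 0 := by positivity
    simp only [Pi.div_apply]
    exact div_div_div_cancel_right₀ this _ _
  have hupp : Tendsto (fun n : ℕ => N (τ (n + 1)) / τ n) atTop (𝓝 (b / a)) := by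
    refine (h2'.div h1 ha.ne').congr' ?_
    filter_upwards [eventually_gt_atTop 0] with n hn
    have : (n : ℝ) ≠ 0 := by positivity
    simp only [Pi.div_apply]
    exact div_div_div_cancel_right₀ this _ _
  refine tendsto_of_tendsto_of_tendsto_of_le_of_le' (hlow.comp hm) (hupp.comp hm) ?_ ?_
  · filter_upwards [eventually_gt_atTop 0] with t ht
    have ht' : (0 : ℝ) < t := by exact_mod_cast ht
    have h3 : (t : ℝ) ≤ τ (m t + 1) := by exact_mod_cast (hm2 t).le
    exact div_le_div₀ (hN0 t) (hN (hm1 t)) ht' h3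
  · filter_upwards [hm.eventually (eventually_gt_atTop 0)] with t ht
    have h0 : 0 < τ (m t) := by
      have := hτ ht
      omega
    have h0' : (0 : ℝ) < τ (m t) := by exact_mod_cast h0
    have h3 : (τ (m t) : ℝ) ≤ t := by exact_mod_cast hm1 t
    exact div_le_div₀ (hN0 _) (hN (hm2 t).le) h0' h3

/-- The ergodic theorem for a chain started at a positive recurrent state `x`. -/
theorem IsTrajectoryLaw.tendsto_sum_div [MeasurableSpace A] [DiscreteMeasurableSpace A]
    [Countable A] {next : A → S} {p : S → PMF A} {Q : S → Measure (ℕ → A)} {x : S}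
    (h : IsTrajectoryLaw next p Q)
    (hx : ∑' k, survival (fun s => (p s).map next) x k x ≠ ∞) (g : A → NNReal)
    (hg : ∀ a, g a ≤ 1) :
    ∀ᵐ ω ∂Q x, Tendsto (fun t : ℕ => (∑ u ∈ Finset.range t, (g (ω u) : ℝ)) / t) atTop
      (𝓝 ((∑' s, occupation (fun s => (p s).map next) x s * ∑' a, p s a * g a).toReal
        / (∑' s, occupation (fun s => (p s).map next) x s).toReal)) := by
  filter_upwards [h.tendsto_sum_returnTime hx g hg,
    h.tendsto_sum_returnTime hx (fun _ => 1) fun _ => le_rfl] with ω h1 h2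
  have hτ : StrictMono fun n => returnTime next x n ω := by
    refine strictMono_nat_of_lt_succ fun n => ?_
    simp only [returnTime, Finset.sum_range_succ]
    omega
  refine tendsto_div_of_tendsto_subseq (N := fun t => ∑ u ∈ Finset.range t, (g (ω u) : ℝ))
    ?_ (fun t => Finset.sum_nonneg fun _ _ => NNReal.coe_nonneg _) hτ (by simp [returnTime]) ?_ ?_
    h1
  · intro s t hst
    exact Finset.sum_le_sum_of_subset_of_nonneg (Finset.range_mono hst)
      fun _ _ _ => NNReal.coe_nonneg _
  · refine ENNReal.toReal_pos (fun h0 => ?_) ?_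
    · have := (ENNReal.tsum_eq_zero.mp h0) x
      rw [occupation_self] at this
      exact one_ne_zero this
    · rw [tsum_occupation]
      exact hx
  · simpa using h2

end MarkovChain

/-! ### The trajectories of the matching model -/

namespace MarkovChain

variable {A : Type*} [Countable A] [MeasurableSpace A] [DiscreteMeasurableSpace A]

/-- The trajectories which agree with `w` up to the time `n`. -/
def cylinderSet (w : ℕ → A) (n : ℕ) : Set (ℕ → A) := {ω | ∀ k ≤ n, ω k = w k}

omit [Countable A] [MeasurableSpace A] [DiscreteMeasurableSpace A] in
lemma cylinderSet_eq (w : ℕ → A) (n : ℕ) :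
    cylinderSet w n = Preorder.frestrictLe (π := fun _ => A) n ⁻¹' {Preorder.frestrictLe n w} := by
  ext ω
  simp only [cylinderSet, Set.mem_ofPred_eq, Set.mem_preimage, Set.mem_singleton_iff]
  constructor
  · intro h
    funext k
    exact h k (Finset.mem_Iic.mp k.2)
  · intro h k hk
    exact congrFun h ⟨k, Finset.mem_Iic.mpr hk⟩

omit [Countable A] in
lemma measurableSet_cylinderSet (w : ℕ → A) (n : ℕ) : MeasurableSet (cylinderSet w n) := by
  have : cylinderSet w n = ⋂ k, ⋂ (_ : k ≤ n), (fun ω : ℕ → A => ω k) ⁻¹' {w k} := by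
    ext ω; simp [cylinderSet]
  rw [this]
  exact MeasurableSet.iInter fun t => MeasurableSet.iInter fun _ =>
    measurable_pi_apply t (MeasurableSet.of_discrete)

lemma measure_ext_of_cylinderSet [Nonempty A] {μ ν : Measure (ℕ → A)} [IsFiniteMeasure μ]
    (h : ∀ w n, μ (cylinderSet w n) = ν (cylinderSet w n)) : μ = ν := by
  have hIic : ∀ n, μ.map (Preorder.frestrictLe (π := fun _ => A) n) = ν.map (Preorder.frestrictLe n) := by
    intro n
    refine Measure.ext_of_singleton fun u => ?_
    let w : ℕ → A := fun k => if hk : k ≤ n then u ⟨k, Finset.mem_Iic.mpr hk⟩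
      else Classical.arbitrary A
    have hw : Preorder.frestrictLe n w = u := by
      funext k
      have hk : (k : ℕ) ≤ n := Finset.mem_Iic.mp k.2
      simp [w, hk]
    rw [Measure.map_apply (by fun_prop) (measurableSet_singleton u),
      Measure.map_apply (by fun_prop) (measurableSet_singleton u), ← hw, ← cylinderSet_eq, h]
  refine IsProjectiveLimit.unique (P := fun I => μ.map I.restrict) (fun I => rfl) fun I => ?_
  have hsub : I ⊆ Finset.Iic (I.sup id) := fun i hi =>
    Finset.mem_Iic.mpr (Finset.le_sup (f := id) hi)
  have hcomp : (I.restrict : (ℕ → A) → _)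
      = Finset.restrict₂ (π := fun _ : ℕ => A) hsub ∘ Preorder.frestrictLe (I.sup id) := rfl
  rw [hcomp, ← Measure.map_map (by fun_prop) (by fun_prop), ← hIic,
    Measure.map_map (by fun_prop) (by fun_prop)]
  rfl

end MarkovChain

instance MatchingStep.instCountable {V : Type*} [Finite V] {S : Type} [Countable S] :
    Countable (MatchingStep V S) := by
  have : Function.Injective fun a : MatchingStep V S => (a.arrival, a.decision, a.next) := by
    rintro ⟨i, j, s⟩ ⟨i', j', s'⟩ h
    simpa using h
  exact this.countable

instance MatchingStep.instDiscreteMeasurableSpace {V : Type*} {S : Type} :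
    DiscreteMeasurableSpace (MatchingStep V S) := ⟨fun _ => trivial⟩

namespace MatchingProblem

open MarkovChain

variable {V : Type*} [Fintype V] (M : MatchingProblem V) [Nonempty V] (Φ : MatchingPolicy M.graph)

instance (s : Φ.State) : IsProbabilityMeasure (M.pathMeasure Φ s) := by
  unfold pathMeasure
  infer_instance

lemma pathMeasure_cylinderSet_zero (s : Φ.State) (w : ℕ → MatchingStep V Φ.State) :
    M.pathMeasure Φ s (cylinderSet w 0) = M.stepLaw Φ s (w 0) := by
  rw [cylinderSet_eq, ← Measure.map_apply (by fun_prop) (measurableSet_singleton _), pathMeasure,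
    Kernel.trajMeasure, Measure.map_comp _ _ (by fun_prop), Kernel.traj_map_frestrictLe,
    Kernel.partialTraj_self, Measure.id_comp,
    Measure.map_apply (by fun_prop) (measurableSet_singleton _)]
  have : (MeasurableEquiv.piUnique fun _ : Finset.Iic 0 => MatchingStep V Φ.State).symm ⁻¹'
      {Preorder.frestrictLe 0 w} = {w 0} := by
    ext a
    simp only [Set.mem_preimage, Set.mem_singleton_iff]
    constructor
    · intro h
      exact congrFun h ⟨0, Finset.mem_Iic.mpr le_rfl⟩
    · rintro rfl
      funext k
      have hk : (k : ℕ) = 0 := Nat.le_zero.mp (Finset.mem_Iic.mp k.2)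
      simp [hk]
  rw [this, PMF.toMeasure_apply_singleton _ _ (measurableSet_singleton _)]

lemma pathMeasure_cylinderSet_succ (s : Φ.State) (w : ℕ → MatchingStep V Φ.State) (n : ℕ) :
    M.pathMeasure Φ s (cylinderSet w (n + 1))
      = M.pathMeasure Φ s (cylinderSet w n) * M.stepLaw Φ (w n).next (w (n + 1)) := by
  have h := Kernel.map_frestrictLe_trajMeasure_compProd_eq_map_trajMeasure
    (X := fun _ => MatchingStep V Φ.State)
    (μ₀ := (M.stepLaw Φ s).toMeasure) (κ := M.historyKernel Φ) (a := n)
  have h' := congrArg (fun m => m ({Preorder.frestrictLe n w} ×ˢ {w (n + 1)})) h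
  beta_reduce at h'
  rw [Measure.compProd_apply_prod (measurableSet_singleton _) (measurableSet_singleton _),
    Measure.map_apply (by fun_prop)
      ((measurableSet_singleton _).prod (measurableSet_singleton _)),
    Measure.restrict_singleton, lintegral_smul_measure, lintegral_dirac,
    Measure.map_apply (by fun_prop) (measurableSet_singleton _), ← cylinderSet_eq] at h'
  have e1 : (fun x : ℕ → MatchingStep V Φ.State => (Preorder.frestrictLe n x, x (n + 1))) ⁻¹'
      ({Preorder.frestrictLe n w} ×ˢ {w (n + 1)}) = cylinderSet w (n + 1) := by
    have : (fun x : ℕ → MatchingStep V Φ.State => (Preorder.frestrictLe n x, x (n + 1))) ⁻¹'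
      ({Preorder.frestrictLe n w} ×ˢ {w (n + 1)})
        = cylinderSet w n ∩ {ω | ω (n + 1) = w (n + 1)} := by
      rw [cylinderSet_eq]; rfl
    rw [this]
    ext ω
    simp only [cylinderSet, Set.mem_inter_iff, Set.mem_ofPred_eq]
    constructor
    · rintro ⟨h1, h2⟩ k hk
      rcases Nat.lt_or_eq_of_le hk with hk | rfl
      · exact h1 k (by omega)
      · exact h2
    · exact fun h => ⟨fun k hk => h k (by omega), h _ le_rfl⟩
  have e2 : M.historyKernel Φ n (Preorder.frestrictLe n w) {w (n + 1)}
      = M.stepLaw Φ (w n).next (w (n + 1)) := by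
    have : M.historyKernel Φ n (Preorder.frestrictLe n w)
        = (M.stepLaw Φ (w n).next).toMeasure := rfl
    rw [this, PMF.toMeasure_apply_singleton _ _ (measurableSet_singleton _)]
  rw [e1, e2] at h'
  exact h'.symm

lemma pathMeasure_cylinderSet_succ' (s : Φ.State) (w : ℕ → MatchingStep V Φ.State) (n : ℕ) :
    M.pathMeasure Φ s (cylinderSet w (n + 1))
      = M.stepLaw Φ s (w 0) * M.pathMeasure Φ (w 0).next (cylinderSet (shift 1 w) n) := by
  induction n with
  | zero =>
    rw [pathMeasure_cylinderSet_succ, pathMeasure_cylinderSet_zero, pathMeasure_cylinderSet_zero]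
    rfl
  | succ n ih =>
    rw [pathMeasure_cylinderSet_succ, ih, pathMeasure_cylinderSet_succ, mul_assoc]
    rfl

theorem isTrajectoryLaw_pathMeasure :
    IsTrajectoryLaw MatchingStep.next (M.stepLaw Φ) (M.pathMeasure Φ) := by
  refine ⟨fun s => inferInstance, fun s F hF => ?_⟩
  have : Nonempty (MatchingStep V Φ.State) := ⟨⟨Classical.arbitrary V, none, s⟩⟩
  have key : M.pathMeasure Φ s = Measure.sum fun a =>
      M.stepLaw Φ s a • (M.pathMeasure Φ a.next).map (cons a) := by
    refine measure_ext_of_cylinderSet fun w n => ?_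
    rw [Measure.sum_apply _ (measurableSet_cylinderSet w n)]
    simp only [Measure.smul_apply, smul_eq_mul]
    simp_rw [Measure.map_apply (measurable_cons _) (measurableSet_cylinderSet w n)]
    rw [tsum_eq_single (w 0)]
    · cases n with
      | zero =>
        have : cons (w 0) ⁻¹' cylinderSet w 0 = Set.univ := by
          refine Set.eq_univ_of_forall fun ω k hk => ?_
          obtain rfl : k = 0 := by omega
          rfl
        rw [this, measure_univ, mul_one, pathMeasure_cylinderSet_zero]
      | succ n =>
        have : cons (w 0) ⁻¹' cylinderSet w (n + 1) = cylinderSet (shift 1 w) n := by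
          ext ω
          simp only [cylinderSet, Set.mem_preimage, Set.mem_ofPred_eq]
          constructor
          · exact fun h k hk => h (k + 1) (by omega)
          · rintro h (_ | k) hk
            · rfl
            · exact h k (by omega)
        rw [this, pathMeasure_cylinderSet_succ']
    · intro a ha
      have : cons a ⁻¹' cylinderSet w n = ∅ := by
        refine Set.eq_empty_of_forall_notMem fun ω hω => ha (hω 0 (Nat.zero_le n))
      rw [this, measure_empty, mul_zero]
  conv_lhs => rw [key]
  rw [lintegral_sum_measure]
  refine tsum_congr fun a => ?_
  rw [lintegral_smul_measure, lintegral_map hF (measurable_cons a), smul_eq_mul]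

end MatchingProblem

/-! ### Matching rates of stable policies -/

namespace MatchingProblem

open MarkovChain

variable {V : Type*} [Fintype V] (M : MatchingProblem V) [Nonempty V] (Φ : MatchingPolicy M.graph)

/-- The transition probabilities of the chain of states. -/
noncomputable def transition (s : Φ.State) : PMF Φ.State :=
  (M.stepLaw Φ s).map MatchingStep.next

lemma lintegral_hittingTime (x : Φ.State) :
    ∫⁻ ω, hittingTime x ω ∂M.pathMeasure Φ x = ∑' k, survival (M.transition Φ) x k x := by
  classical
  have h := (M.isTrajectoryLaw_pathMeasure Φ).lintegral_tsum_avoid x (fun _ => 1)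
  simp only [mul_one, PMF.tsum_coe] at h
  have hocc := tsum_occupation (M.transition Φ) x
  unfold transition at hocc ⊢
  rw [← hocc, ← h]
  refine lintegral_congr fun ω => ?_
  by_cases hω : ∃ t, (ω t).next = x
  · have h1 := tsum_avoid_eq (x := x) (next := MatchingStep.next) hω (fun _ => 1)
    simp only [ENNReal.coe_one] at h1
    rw [h1, excursionSum]
    simp only [NNReal.coe_one, Finset.sum_const, Finset.card_range, nsmul_eq_mul, mul_one]
    rw [ENNReal.ofReal_natCast, hittingTime]
    refine le_antisymm ?_ ?_
    · exact iInf₂_le_of_le _ (mem_firstReturn hω).1 le_rfl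
    · refine le_iInf₂ fun t ht => ?_
      have : returnIndex MatchingStep.next x ω ≤ t := Nat.sInf_le ht
      exact_mod_cast Nat.succ_le_succ this
  · push Not at hω
    have h1 : hittingTime x ω = ∞ := by simp [hittingTime, hω]
    rw [h1]
    simp [hω]

lemma isStable_iff : M.IsStable Φ ↔ ∀ x, ∑' k, survival (M.transition Φ) x k x < ∞ := by
  simp only [IsStable, lintegral_hittingTime]

lemma arrivalLaw_apply (i : V) :
    M.arrivalLaw i = ENNReal.ofReal (M.rate i) / ENNReal.ofReal (∑ j, M.rate j) := by
  rw [arrivalLaw, PMF.normalize_apply, tsum_fintype,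
    ENNReal.ofReal_sum_of_nonneg fun i _ => (M.rate_pos i).le, ENNReal.div_eq_inv_mul, mul_comm]

lemma arrivalLaw_ne_zero (i : V) : M.arrivalLaw i ≠ 0 := by
  rw [arrivalLaw_apply]
  refine ENNReal.div_ne_zero.mpr ⟨?_, ENNReal.ofReal_ne_top⟩
  simpa using M.rate_pos i

lemma sum_rate_pos : 0 < ∑ i, M.rate i :=
  Finset.sum_pos (fun i _ => M.rate_pos i) Finset.univ_nonempty

lemma sum_rate_mul_arrivalLaw (i : V) : (∑ j, M.rate j) * (M.arrivalLaw i).toReal = M.rate i := by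
  rw [arrivalLaw_apply, ENNReal.toReal_div, ENNReal.toReal_ofReal (M.rate_pos i).le,
    ENNReal.toReal_ofReal M.sum_rate_pos.le, mul_div_cancel₀ _ M.sum_rate_pos.ne']

lemma tsum_bind_mul {α β : Type*} (q : PMF α) (f : α → PMF β) (g : β → ℝ≥0∞) :
    ∑' b, (q.bind f) b * g b = ∑' a, q a * ∑' b, f a b * g b := by
  simp only [PMF.bind_apply, ← ENNReal.tsum_mul_right, ← ENNReal.tsum_mul_left, mul_assoc]
  exact ENNReal.tsum_comm

lemma tsum_stepLaw_mul (s : Φ.State) (g : MatchingStep V Φ.State → ℝ≥0∞) :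
    ∑' a, M.stepLaw Φ s a * g a
      = ∑ i, M.arrivalLaw i * ∑' q : Option V × Φ.State, Φ.law s i q * g ⟨i, q.1, q.2⟩ := by
  rw [stepLaw, tsum_bind_mul, tsum_fintype]
  exact Finset.sum_congr rfl fun i _ => by rw [tsum_map_mul]

lemma stepLaw_ne_zero_iff (s : Φ.State) (a : MatchingStep V Φ.State) :
    M.stepLaw Φ s a ≠ 0 ↔ Φ.law s a.arrival (a.decision, a.next) ≠ 0 := by
  rw [← PMF.mem_support_iff, stepLaw, PMF.mem_support_bind_iff]
  constructor
  · rintro ⟨i, -, hi⟩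
    rw [PMF.mem_support_map_iff] at hi
    obtain ⟨q, hq, rfl⟩ := hi
    exact (PMF.mem_support_iff _ _).mp hq
  · intro h
    refine ⟨a.arrival, (PMF.mem_support_iff _ _).mpr (M.arrivalLaw_ne_zero _), ?_⟩
    rw [PMF.mem_support_map_iff]
    exact ⟨_, (PMF.mem_support_iff _ _).mpr h, rfl⟩

lemma transition_ne_zero_iff (s t : Φ.State) :
    M.transition Φ s t ≠ 0 ↔ ∃ i j, Φ.law s i (j, t) ≠ 0 := by
  rw [← PMF.mem_support_iff, transition, PMF.mem_support_map_iff]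
  constructor
  · rintro ⟨a, ha, rfl⟩
    exact ⟨_, _, (M.stepLaw_ne_zero_iff Φ s a).mp ((PMF.mem_support_iff _ _).mp ha)⟩
  · rintro ⟨i, j, h⟩
    exact ⟨⟨i, j, t⟩, (PMF.mem_support_iff _ _).mpr ((M.stepLaw_ne_zero_iff Φ s ⟨i, j, t⟩).mpr h),
      rfl⟩

lemma reachable (s t : Φ.State) :
    Relation.ReflTransGen (fun a b => M.transition Φ a b ≠ 0) s t := by
  simp only [transition_ne_zero_iff]
  exact Φ.irreducible s t

lemma tsum_transition_mul (s : Φ.State) (h : Φ.State → ℝ≥0∞) :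
    ∑' t, M.transition Φ s t * h t = ∑' a, M.stepLaw Φ s a * h a.next :=
  tsum_map_mul _ _ _

/-- An invariant probability makes the policy stable. -/
lemma isStable_of_isInvariant {π : Φ.State → ℝ≥0∞} (hπ : IsInvariant (M.transition Φ) π)
    (hsum : ∑' s, π s = 1) : M.IsStable Φ := by
  rw [isStable_iff]
  intro x
  obtain ⟨s, hs⟩ : ∃ s, π s ≠ 0 := by
    by_contra! h
    simp [h] at hsum
  exact hπ.tsum_survival_lt_top hsum (hπ.pos_of_reachable hs (M.reachable Φ s x))

/-- The step matches an item along the edge `e`. -/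
def MatchesAlong {S : Type} (a : MatchingStep V S) (e : Sym2 V) : Prop :=
  ∃ j, a.decision = some j ∧ s(a.arrival, j) = e

/-- The step matches an item of class `v`. -/
def MatchesClass {S : Type} (a : MatchingStep V S) (v : V) : Prop :=
  ∃ j, a.decision = some j ∧ v ∈ s(a.arrival, j)

open Classical in
/-- The probability that the arrival in state `s` produces a match along `e`. -/
noncomputable def matchProb (s : Φ.State) (e : Sym2 V) : ℝ≥0∞ :=
  ∑' a, M.stepLaw Φ s a * (if MatchesAlong a e then 1 else 0)

/-- The matching rates, as means over an excursion from the empty state. -/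
noncomputable def excursionRates (e : M.graph.edgeSet) : ℝ :=
  (∑ i, M.rate i) * ((∑' s, occupation (M.transition Φ) Φ.empty s * M.matchProb Φ s e).toReal
    / (∑' s, occupation (M.transition Φ) Φ.empty s).toReal)

lemma matchProb_le_one (s : Φ.State) (e : Sym2 V) : M.matchProb Φ s e ≤ 1 := by
  classical
  rw [matchProb, ← (M.stepLaw Φ s).tsum_coe]
  exact ENNReal.tsum_le_tsum fun a => mul_le_of_le_one_right zero_le (by split_ifs <;> simp)

variable {M Φ}

lemma IsStable.tsum_occupation_ne_top (h : M.IsStable Φ) :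
    ∑' s, occupation (M.transition Φ) Φ.empty s ≠ ∞ := by
  rw [tsum_occupation]
  exact ((M.isStable_iff Φ).mp h _).ne

lemma IsStable.isInvariant_occupation (h : M.IsStable Φ) :
    IsInvariant (M.transition Φ) (occupation (M.transition Φ) Φ.empty) :=
  MarkovChain.isInvariant_occupation ((M.isStable_iff Φ).mp h _)

lemma IsStable.occupation_ne_zero (h : M.IsStable Φ) (s : Φ.State) :
    occupation (M.transition Φ) Φ.empty s ≠ 0 :=
  h.isInvariant_occupation.pos_of_reachable (by rw [occupation_self]; exact one_ne_zero)
    (M.reachable Φ Φ.empty s)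

variable (M Φ) in
lemma tsum_occupation_ne_zero : ∑' s, occupation (M.transition Φ) Φ.empty s ≠ 0 := by
  intro h0
  have := (ENNReal.tsum_eq_zero.mp h0) Φ.empty
  rw [occupation_self] at this
  exact one_ne_zero this

lemma IsStable.tsum_occupation_pos (h : M.IsStable Φ) :
    0 < (∑' s, occupation (M.transition Φ) Φ.empty s).toReal :=
  ENNReal.toReal_pos (tsum_occupation_ne_zero M Φ) h.tsum_occupation_ne_top

lemma IsStable.tsum_matchProb_ne_top (h : M.IsStable Φ) (e : Sym2 V) :
    ∑' s, occupation (M.transition Φ) Φ.empty s * M.matchProb Φ s e ≠ ∞ :=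
  ne_top_of_le_ne_top h.tsum_occupation_ne_top <|
    ENNReal.tsum_le_tsum fun s => mul_le_of_le_one_right zero_le (M.matchProb_le_one Φ s e)

theorem IsStable.hasMatchingRates (h : M.IsStable Φ) :
    M.HasMatchingRates Φ (M.excursionRates Φ) := by
  classical
  intro e
  have hx : ∑' k, survival (fun s => (M.stepLaw Φ s).map MatchingStep.next) Φ.empty k Φ.empty ≠ ∞ :=
    ((M.isStable_iff Φ).mp h Φ.empty).ne
  have H := (M.isTrajectoryLaw_pathMeasure Φ).tendsto_sum_div hx
    (fun a => if MatchesAlong a (e : Sym2 V) then 1 else 0) (fun a => by split_ifs <;> simp)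
  filter_upwards [H] with ω hω
  have hlim := hω.const_mul (∑ i, M.rate i)
  convert hlim using 2
  · rename_i t
    rw [matchCount, Finset.card_filter]
    push_cast
    congr 2
    refine Finset.sum_congr rfl fun u _ => ?_
    by_cases hm : MatchesAlong (ω u) (e : Sym2 V)
    · rw [if_pos hm, if_pos (show ∃ j, _ from hm)]
      simp
    · rw [if_neg hm, if_neg (show ¬ ∃ j, _ from hm)]
      simp
  · simp only [excursionRates, matchProb]
    congr! 9
    split_ifs <;> simp

lemma HasMatchingRates.unique {μ ν : M.graph.edgeSet → ℝ} (hμ : M.HasMatchingRates Φ μ)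
    (hν : M.HasMatchingRates Φ ν) : μ = ν := by
  funext e
  obtain ⟨ω, h1, h2⟩ := ((hμ e).and (hν e)).exists
  exact tendsto_nhds_unique h1 h2

/-- All items of class `v` are created by arrivals and destroyed by matches. -/
lemma queue_balance {s : Φ.State} {a : MatchingStep V Φ.State} (ha : M.stepLaw Φ s a ≠ 0) (v : V) :
    open Classical in
    Φ.queue a.next v + (if MatchesClass a v then 1 else 0)
      = Φ.queue s v + (if a.arrival = v then 1 else 0) := by
  classical
  obtain ⟨i, j, t⟩ := a
  rw [stepLaw_ne_zero_iff] at ha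
  simp only at ha ⊢
  cases j with
  | none =>
    have h1 := Φ.queue_none s i t ha v
    simp only [MatchesClass, reduceCtorEq, false_and, exists_false, if_false, add_zero, h1, eq_comm]
  | some j =>
    have h1 := Φ.queue_some s i j t ha v
    have hij : i ≠ j := (Φ.adapted s i j t ha).1.ne
    have h2 : MatchesClass (⟨i, some j, t⟩ : MatchingStep V Φ.State) v ↔ v = i ∨ v = j := by
      simp [MatchesClass]
    rw [← h1]
    simp only [h2]
    by_cases hvi : v = i
    · subst hvi
      simp [hij]
    · by_cases hvj : v = j
      · subst hvj
        simp [hvi, Ne.symm hvi]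
      · simp [hvi, hvj, Ne.symm hvi]

open Classical in
/-- The probability that the arrival in state `s` produces a match of an item of class `v`. -/
noncomputable def classProb (M : MatchingProblem V) (Φ : MatchingPolicy M.graph) (s : Φ.State)
    (v : V) : ℝ≥0∞ :=
  ∑' a, M.stepLaw Φ s a * (if MatchesClass a v then 1 else 0)

open Classical in
variable (M Φ) in
lemma tsum_transition_queue (s : Φ.State) (v : V) :
    ∑' t, M.transition Φ s t * (Φ.queue t v : ℝ≥0∞) + classProb M Φ s v
      = Φ.queue s v + M.arrivalLaw v := by
  rw [tsum_transition_mul, classProb, ← ENNReal.tsum_add]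
  have h1 : ∀ a, M.stepLaw Φ s a * (Φ.queue a.next v : ℝ≥0∞)
      + M.stepLaw Φ s a * (if MatchesClass a v then 1 else 0)
      = M.stepLaw Φ s a * (Φ.queue s v : ℝ≥0∞)
        + M.stepLaw Φ s a * (if a.arrival = v then 1 else 0) := by
    intro a
    by_cases ha : M.stepLaw Φ s a = 0
    · simp [ha]
    · rw [← mul_add, ← mul_add]
      congr 1
      exact_mod_cast queue_balance ha v
  rw [tsum_congr h1, ENNReal.tsum_add, ENNReal.tsum_mul_right, PMF.tsum_coe, one_mul,
    tsum_stepLaw_mul]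
  congr 1
  rw [Finset.sum_eq_single v]
  · simp
  · intro i _ hi
    simp [hi]
  · simp

/-- In the `n` steps after a visit to the empty state, a queue grows to at most `n`. -/
lemma queue_le_of_taboo {n : ℕ} {s : Φ.State} (h : taboo (M.transition Φ) Φ.empty n s ≠ 0) (v : V) :
    Φ.queue s v ≤ n := by
  classical
  induction n generalizing s with
  | zero =>
    have hs : s = Φ.empty := by
      by_contra hne
      simp [taboo, hne] at h
    rw [(Φ.queue_eq_zero_iff s).mpr hs]
    simp
  | succ n ih =>
    have h' : ∑' r, taboo (M.transition Φ) Φ.empty n r * M.transition Φ r s ≠ 0 := by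
      intro h0
      simp [taboo, h0] at h
    obtain ⟨r, hr⟩ : ∃ r, taboo (M.transition Φ) Φ.empty n r * M.transition Φ r s ≠ 0 := by
      by_contra! hall
      exact h' (by simp [hall])
    have h1 := ih (left_ne_zero_of_mul hr)
    have h2 := right_ne_zero_of_mul hr
    rw [transition, ← PMF.mem_support_iff, PMF.mem_support_map_iff] at h2
    obtain ⟨a, ha, rfl⟩ := h2
    have h3 := queue_balance ((PMF.mem_support_iff _ _).mp ha) v
    split_ifs at h3 <;> omega

/-- Conservation: over an excursion from the empty state, as many items of class `v` arrive as are
matched. The queue left at time `n`, on the event that the excursion is longer than `n`, is at most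
`n`, so that its mean vanishes in the limit. -/
lemma IsStable.tsum_classProb (h : M.IsStable Φ) (v : V) :
    ∑' s, occupation (M.transition Φ) Φ.empty s * classProb M Φ s v
      = M.arrivalLaw v * ∑' s, occupation (M.transition Φ) Φ.empty s := by
  classical
  set f := taboo (M.transition Φ) Φ.empty with hf
  set u : ℕ → ℝ≥0∞ := fun k => survival (M.transition Φ) Φ.empty k Φ.empty with hu
  have hufin : ∑' k, u k ≠ ∞ := ((M.isStable_iff Φ).mp h Φ.empty).ne
  let a : ℕ → ℝ≥0∞ := fun n => ∑' s, f n s * (Φ.queue s v : ℝ≥0∞)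
  let m : ℕ → ℝ≥0∞ := fun n => ∑' s, f n s * classProb M Φ s v
  have hq0 : Φ.queue Φ.empty v = 0 := by
    rw [(Φ.queue_eq_zero_iff Φ.empty).mpr rfl]; rfl
  have hstep : ∀ n, a (n + 1) + m n = a n + M.arrivalLaw v * u n := by
    intro n
    have h1 : a (n + 1) = ∑' t, (∑' s, f n s * M.transition Φ s t) * (Φ.queue t v : ℝ≥0∞) := by
      refine tsum_congr fun t => ?_
      by_cases ht : t = Φ.empty
      · simp [ht, hq0]
      · simp [hf, taboo, ht]
    rw [h1, tsum_mul_transition, ← ENNReal.tsum_add]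
    simp_rw [← mul_add, tsum_transition_queue, mul_add]
    rw [ENNReal.tsum_add, ENNReal.tsum_mul_right, tsum_taboo, mul_comm (M.arrivalLaw v)]
  have hsum : ∀ n, a n + ∑ k ∈ Finset.range n, m k
      = M.arrivalLaw v * ∑ k ∈ Finset.range n, u k := by
    intro n
    induction n with
    | zero =>
      have : a 0 = 0 := by
        refine ENNReal.tsum_eq_zero.mpr fun s => ?_
        by_cases hs : s = Φ.empty
        · simp [hs, hq0]
        · simp [hf, taboo, hs]
      simp [this]
    | succ n ih =>
      rw [Finset.sum_range_succ, Finset.sum_range_succ, mul_add, ← ih]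
      calc a (n + 1) + (∑ k ∈ Finset.range n, m k + m n)
          = (a (n + 1) + m n) + ∑ k ∈ Finset.range n, m k := by ring
        _ = _ := by rw [hstep]; ring
  have hale : ∀ n, a n ≤ n * u n := by
    intro n
    calc a n ≤ ∑' s, f n s * n := by
          refine ENNReal.tsum_le_tsum fun s => ?_
          by_cases hs : f n s = 0
          · simp [hs]
          · gcongr
            exact queue_le_of_taboo hs v
      _ = n * u n := by rw [ENNReal.tsum_mul_right, tsum_taboo, mul_comm]
  have htwo : Tendsto (fun n : ℕ => 2 * n) atTop atTop :=
    tendsto_id.const_mul_atTop' (by norm_num)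
  have ha0 : Tendsto (fun n => a (2 * n)) atTop (𝓝 0) :=
    tendsto_of_tendsto_of_tendsto_of_le_of_le tendsto_const_nhds
      (tendsto_even_mul_zero_of_antitone (survival_antitone _ _) hufin)
      (fun _ => zero_le) fun n => hale (2 * n)
  have hl : Tendsto (fun n => a (2 * n) + ∑ k ∈ Finset.range (2 * n), m k) atTop
      (𝓝 (0 + ∑' k, m k)) :=
    ha0.add ((ENNReal.tendsto_nat_tsum m).comp htwo)
  have hr : Tendsto (fun n => M.arrivalLaw v * ∑ k ∈ Finset.range (2 * n), u k) atTop
      (𝓝 (M.arrivalLaw v * ∑' k, u k)) :=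
    ENNReal.Tendsto.const_mul ((ENNReal.tendsto_nat_tsum u).comp htwo)
      (Or.inr (PMF.apply_ne_top _ _))
  simp only [hsum, zero_add] at hl
  have hmu := tendsto_nhds_unique hl hr
  rw [tsum_occupation]
  simp only [occupation, ← ENNReal.tsum_mul_right]
  rw [ENNReal.tsum_comm]
  exact hmu

end MatchingProblem

/-! ### Solutions of the conservation equation -/

open Classical in
lemma SimpleGraph.incMap_apply {V : Type*} [Fintype V] (G : SimpleGraph V) (y : G.edgeSet → ℝ)
    (v : V) : G.incMap y v = ∑ e : G.edgeSet, if v ∈ (e : Sym2 V) then y e else 0 := by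
  simp only [incMap, edgeIncMatrix, Matrix.mulVecLin_apply, Matrix.mulVec, dotProduct,
    Matrix.submatrix_apply, id]
  refine Finset.sum_congr rfl fun e _ => ?_
  rw [G.incMatrix_apply']
  have : (e : Sym2 V) ∈ G.incidenceSet v ↔ v ∈ (e : Sym2 V) :=
    ⟨fun h => h.2, fun h => ⟨e.2, h⟩⟩
  simp [this]

namespace MatchingProblem

open MarkovChain

variable {V : Type*} [Fintype V] {M : MatchingProblem V} [Nonempty V]
  {Φ : MatchingPolicy M.graph}

lemma edge_of_stepLaw {s : Φ.State} {a : MatchingStep V Φ.State} (ha : M.stepLaw Φ s a ≠ 0) {j : V}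
    (hj : a.decision = some j) : M.graph.Adj a.arrival j := by
  rw [stepLaw_ne_zero_iff, hj] at ha
  exact (Φ.adapted _ _ _ _ ha).1

open Classical in
variable (M Φ) in
lemma sum_matchProb (s : Φ.State) (v : V) :
    (∑ e : M.graph.edgeSet, if v ∈ (e : Sym2 V) then M.matchProb Φ s e else 0)
      = classProb M Φ s v := by
  have h1 : ∀ e : M.graph.edgeSet, (if v ∈ (e : Sym2 V) then M.matchProb Φ s e else 0)
      = ∑' a, M.stepLaw Φ s a *
        (if v ∈ (e : Sym2 V) then (if MatchesAlong a (e : Sym2 V) then 1 else 0) else 0) := by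
    intro e
    split_ifs
    · rfl
    · simp
  simp_rw [h1]
  rw [← Summable.tsum_finsetSum fun _ _ => ENNReal.summable, classProb]
  refine tsum_congr fun a => ?_
  rw [← Finset.mul_sum]
  by_cases ha : M.stepLaw Φ s a = 0
  · simp [ha]
  congr 1
  rcases hd : a.decision with _ | j
  · simp [MatchesAlong, MatchesClass, hd]
  · have hadj := edge_of_stepLaw ha hd
    rw [Finset.sum_eq_single ⟨s(a.arrival, j), hadj⟩]
    · simp [MatchesAlong, MatchesClass, hd]
    · intro e _ he
      have : ¬ MatchesAlong a (e : Sym2 V) := by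
        rintro ⟨j', hj', hej⟩
        rw [hd] at hj'
        obtain rfl := Option.some.inj hj'
        exact he (Subtype.ext hej.symm)
      simp [this]
    · simp

lemma IsStable.excursionRates_mem_solutions (h : M.IsStable Φ) :
    M.excursionRates Φ ∈ M.solutions := by
  classical
  refine funext fun v => ?_
  rw [SimpleGraph.incMap_apply]
  set T := ∑' s, occupation (M.transition Φ) Φ.empty s with hT
  have hsum : ∑ e : M.graph.edgeSet, (if v ∈ (e : Sym2 V) then
      (∑' s, occupation (M.transition Φ) Φ.empty s * M.matchProb Φ s e).toReal else 0)
      = (M.arrivalLaw v * T).toReal := by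
    rw [← h.tsum_classProb v]
    simp_rw [← sum_matchProb, Finset.mul_sum]
    rw [Summable.tsum_finsetSum fun _ _ => ENNReal.summable, ENNReal.toReal_sum]
    · refine Finset.sum_congr rfl fun e _ => ?_
      split_ifs <;> simp
    · intro e _
      split_ifs
      · exact h.tsum_matchProb_ne_top e
      · simp
  calc (∑ e : M.graph.edgeSet, if v ∈ (e : Sym2 V) then M.excursionRates Φ e else 0)
      = (∑ i, M.rate i) * ((∑ e : M.graph.edgeSet, (if v ∈ (e : Sym2 V) then
        (∑' s, occupation (M.transition Φ) Φ.empty s * M.matchProb Φ s e).toReal else 0))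
          / T.toReal) := by
        rw [Finset.sum_div, Finset.mul_sum]
        refine Finset.sum_congr rfl fun e _ => ?_
        rw [excursionRates, ← hT]
        split_ifs <;> simp
    _ = (∑ i, M.rate i) * (M.arrivalLaw v).toReal := by
        rw [hsum, ENNReal.toReal_mul, mul_div_cancel_right₀ _ h.tsum_occupation_pos.ne']
    _ = M.rate v := M.sum_rate_mul_arrivalLaw v

variable (M Φ) in
lemma excursionRates_nonneg (e : M.graph.edgeSet) : 0 ≤ M.excursionRates Φ e :=
  mul_nonneg M.sum_rate_pos.le (div_nonneg ENNReal.toReal_nonneg ENNReal.toReal_nonneg)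

lemma IsStable.excursionRates_pos (h : M.IsStable Φ) {e : M.graph.edgeSet} {s : Φ.State}
    (hs : M.matchProb Φ s e ≠ 0) : 0 < M.excursionRates Φ e := by
  refine mul_pos M.sum_rate_pos (div_pos (ENNReal.toReal_pos ?_ (h.tsum_matchProb_ne_top e))
    h.tsum_occupation_pos)
  intro h0
  exact mul_ne_zero (h.occupation_ne_zero s) hs (ENNReal.tsum_eq_zero.mp h0 s)

lemma matchProb_ne_zero {s : Φ.State} {a : MatchingStep V Φ.State} (ha : M.stepLaw Φ s a ≠ 0)
    {e : Sym2 V} (he : MatchesAlong a e) : M.matchProb Φ s e ≠ 0 := by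
  classical
  intro h0
  have := ENNReal.tsum_eq_zero.mp h0 a
  rw [if_pos he, mul_one] at this
  exact ha this

/-- A greedy policy uses each edge `ij`: it does so when items of the classes `i` and `j` arrive
consecutively from the empty state. -/
lemma exists_matchProb_ne_zero_of_isGreedy (hΦ : Φ.IsGreedy) (e : M.graph.edgeSet) :
    ∃ s, M.matchProb Φ s e ≠ 0 := by
  classical
  obtain ⟨e, he⟩ := e
  induction e using Sym2.ind with
  | _ i j =>
  have hadj : M.graph.Adj i j := he
  have hempty : Φ.queue Φ.empty = 0 := (Φ.queue_eq_zero_iff _).mpr rfl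
  obtain ⟨⟨d, s⟩, hs⟩ := (Φ.law Φ.empty i).support_nonempty
  rw [PMF.mem_support_iff] at hs
  have hd : d = none := by
    cases d with
    | none => rfl
    | some k =>
      have := (Φ.adapted _ _ _ _ hs).2
      simp [hempty] at this
  subst hd
  have hq : ∀ k, Φ.queue s k = if k = i then 1 else 0 := by
    intro k
    rw [Φ.queue_none _ _ _ hs k, hempty]
    simp
  obtain ⟨⟨d, t⟩, ht⟩ := (Φ.law s j).support_nonempty
  rw [PMF.mem_support_iff] at ht
  cases d with
  | none =>
    have h0 := hΦ s j ⟨i, hadj.symm, by simp [hq]⟩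
    exact absurd (ENNReal.tsum_eq_zero.mp h0 t) ht
  | some k =>
    have hk : k = i := by
      by_contra hne
      have := (Φ.adapted _ _ _ _ ht).2
      simp [hq, hne] at this
    subst hk
    exact ⟨s, matchProb_ne_zero (a := ⟨j, some k, t⟩) ((M.stepLaw_ne_zero_iff Φ _ _).mpr ht)
      ⟨k, rfl, Sym2.eq_swap⟩⟩

lemma IsStable.excursionRates_mem_posSolutions (h : M.IsStable Φ) (hΦ : Φ.IsGreedy) :
    M.excursionRates Φ ∈ M.posSolutions := by
  refine ⟨h.excursionRates_mem_solutions, fun e => ?_⟩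
  obtain ⟨s, hs⟩ := exists_matchProb_ne_zero_of_isGreedy hΦ e
  exact h.excursionRates_pos hs

/-- If the weights `x` of the classes cancel on each edge which the stable policy uses, then the
total weight of the queues performs a random walk with steps `x i`. As the chain of states has an
invariant probability, the weights vanish. -/
lemma IsStable.weight_eq_zero (h : M.IsStable Φ) (x : V → ℝ)
    (hx : ∀ i j, M.graph.Adj i j → (∃ s, M.matchProb Φ s s(i, j) ≠ 0) → x i + x j = 0)
    (i : V) : x i = 0 := by
  classical
  set T := ∑' s, occupation (M.transition Φ) Φ.empty s with hT
  let f : Φ.State → ℝ := fun s => ∑ v, x v * Φ.queue s v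
  have hf : ∀ s a, M.stepLaw Φ s a ≠ 0 → f a.next = f s + x a.arrival := by
    intro s a ha
    have h1 : ∀ v, x v * Φ.queue a.next v + x v * (if MatchesClass a v then 1 else 0)
        = x v * Φ.queue s v + x v * (if a.arrival = v then 1 else 0) := by
      intro v
      rw [← mul_add, ← mul_add]
      congr 1
      exact_mod_cast queue_balance ha v
    have h2 : ∑ v, x v * (if MatchesClass a v then (1 : ℝ) else 0) = 0 := by
      rcases hd : a.decision with _ | j
      · simp [MatchesClass, hd]
      · have hadj := edge_of_stepLaw ha hd
        have h3 := hx _ _ hadj ⟨s, matchProb_ne_zero ha ⟨j, hd, rfl⟩⟩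
        have h4 : ∀ v, x v * (if MatchesClass a v then (1 : ℝ) else 0)
            = (if v = a.arrival then x v else 0) + (if v = j then x v else 0) := by
          intro v
          have h5 : MatchesClass a v ↔ v = a.arrival ∨ v = j := by
            simp [MatchesClass, hd]
          have hne := hadj.ne
          simp only [h5]
          by_cases hv1 : v = a.arrival
          · simp [hv1, hne]
          · by_cases hv2 : v = j
            · simp [hv2, hne.symm]
            · simp [hv1, hv2]
        rw [Finset.sum_congr rfl fun v _ => h4 v, Finset.sum_add_distrib]
        simpa using h3
    have h3 := Finset.sum_congr rfl fun v (_ : v ∈ Finset.univ) => h1 v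
    rw [Finset.sum_add_distrib, Finset.sum_add_distrib, h2, add_zero] at h3
    simpa [f] using h3
  let ν : Φ.State → ℝ≥0∞ := fun s => T⁻¹ * occupation (M.transition Φ) Φ.empty s
  have hν : ∀ k : Φ.State → ℝ≥0∞,
      ∑' s, ν s * ∑' a, M.stepLaw Φ s a * k a.next = ∑' s, ν s * k s := by
    intro k
    simp_rw [← tsum_transition_mul, ν, mul_assoc, ENNReal.tsum_mul_left]
    rw [h.isInvariant_occupation.tsum_mul]
  have hν1 : ∑' s, ν s = 1 := by
    simp only [ν]
    rw [ENNReal.tsum_mul_left]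
    exact ENNReal.inv_mul_cancel (tsum_occupation_ne_zero M Φ) h.tsum_occupation_ne_top
  let g : ℝ → ℝ≥0∞ := fun r => ∑' s, ν s * (if f s = r then 1 else 0)
  refine increment_eq_zero_of_convolution (fun i => M.arrivalLaw i) ?_ x g ?_ ?_ i
    (M.arrivalLaw_ne_zero i)
  · rw [← tsum_fintype (L := .unconditional V)]
    exact PMF.tsum_coe _
  · simp only [g]
    rw [ENNReal.tsum_comm]
    refine Eq.trans (tsum_congr fun s => ?_) hν1
    rw [ENNReal.tsum_mul_left, tsum_eq_single (f s)]
    · simp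
    · intro r hr
      simp [hr.symm]
  · intro r
    simp only [g]
    rw [← hν fun s => if f s = r then 1 else 0]
    simp_rw [← ENNReal.tsum_mul_left (a := M.arrivalLaw _)]
    rw [← Summable.tsum_finsetSum fun _ _ => ENNReal.summable]
    refine tsum_congr fun s => ?_
    have h1 : ∑' a, M.stepLaw Φ s a * (if f a.next = r then 1 else 0)
        = ∑' a, M.stepLaw Φ s a * (if f s = r - x a.arrival then 1 else 0) := by
      refine tsum_congr fun a => ?_
      by_cases ha : M.stepLaw Φ s a = 0
      · simp [ha]
      · simp only [hf s a ha, eq_sub_iff_add_eq]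
    rw [h1, tsum_stepLaw_mul, Finset.mul_sum]
    refine Finset.sum_congr rfl fun i _ => ?_
    change ν s * (M.arrivalLaw i * ∑' q, Φ.law s i q * (if f s = r - x i then 1 else 0)) = _
    rw [ENNReal.tsum_mul_right, PMF.tsum_coe, one_mul, mul_left_comm]

/-- A stable policy, greedy or not, produces a positive solution: the edges which it uses suffice
for surjectivity, so that its rates can be shifted slightly to make the unused edges positive. -/
theorem IsStable.posSolutions_nonempty (h : M.IsStable Φ) : M.posSolutions.Nonempty := by
  classical
  let used : M.graph.edgeSet → Prop := fun e => ∃ s, M.matchProb Φ s e ≠ 0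
  let T : (M.graph.edgeSet → ℝ) →ₗ[ℝ] (V → ℝ) :=
    M.graph.incMap.comp (LinearMap.pi fun e => if used e then LinearMap.proj e else 0)
  have hTapply : ∀ w, T w = M.graph.incMap fun e => if used e then w e else 0 := by
    intro w
    simp only [T, LinearMap.comp_apply]
    congr 1
    funext e
    simp only [LinearMap.pi_apply]
    split_ifs <;> rfl
  have hsurj : LinearMap.range T = ⊤ := by
    by_contra hne
    obtain ⟨φ, hφ, hle⟩ := Submodule.exists_le_ker_of_lt_top _ (lt_top_iff_ne_top.mpr hne)
    refine hφ (LinearMap.ext fun w => ?_)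
    have hx : ∀ i, φ (Pi.single i 1) = 0 := by
      refine h.weight_eq_zero (fun i => φ (Pi.single i 1)) fun i j hij hu => ?_
      have h1 : φ (T (Pi.single ⟨s(i, j), hij⟩ 1)) = 0 := hle ⟨_, rfl⟩
      have h2 : T (Pi.single ⟨s(i, j), hij⟩ 1) = Pi.single i 1 + Pi.single j 1 := by
        rw [hTapply]
        funext v
        rw [SimpleGraph.incMap_apply, Finset.sum_eq_single ⟨s(i, j), hij⟩]
        · have hu' : used ⟨s(i, j), hij⟩ := hu
          have hne := hij.ne
          simp only [hu', Pi.single_eq_same, if_true, Sym2.mem_iff, Pi.add_apply, Pi.single_apply]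
          by_cases hvi : v = i
          · subst hvi; simp [hne]
          · simp [hvi]
        · intro e _ he
          simp [he]
        · simp
      rwa [h2, map_add] at h1
    rw [LinearMap.pi_apply_eq_sum_univ φ w]
    refine Finset.sum_eq_zero fun i _ => ?_
    have : (fun j => if i = j then (1 : ℝ) else 0) = Pi.single i 1 := by
      funext j
      simp [Pi.single_apply, eq_comm]
    rw [this, hx, smul_zero]
  obtain ⟨w, hw⟩ : ∃ w, T w = M.graph.incMap fun e => if used e then 0 else 1 := by
    have : M.graph.incMap (fun e => if used e then 0 else 1) ∈ LinearMap.range T := by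
      rw [hsurj]; trivial
    exact this
  let z : M.graph.edgeSet → ℝ :=
    (fun e => if used e then 0 else 1) - fun e => if used e then w e else 0
  have hz : M.graph.incMap z = 0 := by
    rw [map_sub, ← hw, hTapply, sub_self]
  let y := M.excursionRates Φ
  have hev : ∀ᶠ ε : ℝ in 𝓝[>] 0, ∀ e, 0 < y e + ε * z e := by
    rw [eventually_all]
    intro e
    by_cases hu : used e
    · have hy : 0 < y e := by
        obtain ⟨s, hs⟩ := hu
        exact h.excursionRates_pos hs
      have hc : Tendsto (fun ε : ℝ => y e + ε * z e) (𝓝[>] 0) (𝓝 (y e + 0 * z e)) :=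
        ((continuous_const.add (continuous_id.mul continuous_const)).tendsto 0).mono_left
          nhdsWithin_le_nhds
      exact hc.eventually_const_lt (by simpa using hy)
    · filter_upwards [self_mem_nhdsWithin] with ε hε
      have hz1 : z e = 1 := by simp [z, hu]
      rw [hz1, mul_one]
      exact add_pos_of_nonneg_of_pos (excursionRates_nonneg M Φ e) hε
  obtain ⟨ε, hε⟩ := hev.exists
  refine ⟨y + ε • z, ?_, fun e => by simpa using hε e⟩
  change M.graph.incMap _ = _
  rw [map_add, map_smul, hz, smul_zero, add_zero]
  exact h.excursionRates_mem_solutions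

/-! ### Topology of the set of positive solutions -/

omit [Nonempty V] in
lemma isOpen_posSolutions : IsOpen ((↑) ⁻¹' M.posSolutions : Set M.solutions) := by
  have : ((↑) ⁻¹' M.posSolutions : Set M.solutions)
      = ⋂ e, {y : M.solutions | 0 < (y : M.graph.edgeSet → ℝ) e} := by
    ext y
    simp only [Set.mem_preimage, Set.mem_iInter, Set.mem_ofPred_eq]
    exact ⟨fun hy => hy.2, fun hy => ⟨y.2, hy⟩⟩
  rw [this]
  have : Finite M.graph.edgeSet := Subtype.finite
  exact isOpen_iInter_of_finite fun e =>
    isOpen_lt continuous_const ((continuous_apply e).comp continuous_subtype_val)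

omit [Nonempty V] in
lemma affineSpan_nonnegSolutions_subset :
    (affineSpan ℝ M.nonnegSolutions : Set (M.graph.edgeSet → ℝ)) ⊆ M.solutions := by
  have hle : affineSpan ℝ M.nonnegSolutions
      ≤ (AffineSubspace.comap M.graph.incMap.toAffineMap
        (AffineSubspace.mk' M.rate (⊥ : Submodule ℝ (V → ℝ)))) := by
    rw [affineSpan_le]
    intro y hy
    have : M.graph.incMap y = M.rate := hy.1
    simp [this]
  intro y hy
  have := hle hy
  simp only [AffineSubspace.mem_comap, LinearMap.coe_toAffineMap, AffineSubspace.mem_mk',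
    vsub_eq_sub, Submodule.mem_bot, sub_eq_zero] at this
  exact this

omit [Nonempty V] in
/-- Near a positive solution, the points of the affine span are positive solutions as well. -/
lemma posSolutions_subset_intrinsicInterior :
    M.posSolutions ⊆ intrinsicInterior ℝ M.nonnegSolutions := by
  intro y hy
  have hyn : y ∈ M.nonnegSolutions := ⟨hy.1, fun e => (hy.2 e).le⟩
  refine ⟨⟨y, subset_affineSpan ℝ _ hyn⟩, ?_, rfl⟩
  rw [mem_interior]
  refine ⟨⋂ e, {z | 0 < (z : M.graph.edgeSet → ℝ) e}, ?_, ?_, ?_⟩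
  · intro z hz
    rw [Set.mem_iInter] at hz
    exact ⟨affineSpan_nonnegSolutions_subset z.2, fun e => (hz e).le⟩
  · have : Finite M.graph.edgeSet := Subtype.finite
    exact isOpen_iInter_of_finite fun e =>
      isOpen_lt continuous_const ((continuous_apply e).comp continuous_subtype_val)
  · exact Set.mem_iInter.mpr hy.2

omit [Nonempty V] in
lemma disjoint_posSolutions_intrinsicFrontier :
    Disjoint M.posSolutions (intrinsicFrontier ℝ M.nonnegSolutions) := by
  refine Disjoint.mono_left posSolutions_subset_intrinsicInterior ?_
  rw [intrinsicInterior, intrinsicFrontier, Set.disjoint_image_iff Subtype.val_injective]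
  exact disjoint_interior_frontier

end MatchingProblem

/-! ### The match-the-longest policy -/

namespace SimpleGraph

variable {V : Type*} [Fintype V] (G : SimpleGraph V)

/-- No two compatible items are unmatched. -/
def IsIndepQueue (q : V → ℕ) : Prop := ∀ i j, G.Adj i j → q i = 0 ∨ q j = 0

/-- The queue vectors with independent support. They are indexed by `Fin (card V)` in place of `V`,
so that they form a type in the lowest universe. -/
def IndepState : Type :=
  {q : Fin (Fintype.card V) → ℕ // G.IsIndepQueue (q ∘ Fintype.equivFin V)}

variable {G}

namespace IndepState

/-- The queue vector of a state. -/
noncomputable def queue (s : G.IndepState) : V → ℕ := s.1 ∘ Fintype.equivFin V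

/-- The state with a given queue vector. -/
noncomputable def ofQueue (q : V → ℕ) (hq : G.IsIndepQueue q) : G.IndepState :=
  ⟨q ∘ (Fintype.equivFin V).symm, by simpa [Function.comp_assoc] using hq⟩

@[simp] lemma queue_ofQueue (q : V → ℕ) (hq : G.IsIndepQueue q) : (ofQueue q hq).queue = q := by
  simp [queue, ofQueue, Function.comp_assoc]

lemma queue_injective : Function.Injective (queue : G.IndepState → V → ℕ) := by
  intro s t h
  refine Subtype.ext (funext fun k => ?_)
  have := congrFun h ((Fintype.equivFin V).symm k)
  simpa [queue] using this

lemma isIndepQueue (s : G.IndepState) : G.IsIndepQueue s.queue := s.2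

end IndepState

omit [Fintype V] in
lemma isIndepQueue_zero : G.IsIndepQueue (0 : V → ℕ) := fun _ _ _ => Or.inl rfl

omit [Fintype V] in
lemma IsIndepQueue.mono {q r : V → ℕ} (hq : G.IsIndepQueue q) (h : r ≤ q) : G.IsIndepQueue r := by
  intro i j hij
  have h1 : r i ≤ q i := h i
  have h2 : r j ≤ q j := h j
  rcases hq i j hij with h0 | h0
  · left; omega
  · right; omega

instance : Countable G.IndepState :=
  Subtype.countable

lemma finite_sum_queue_le (n : ℕ) : {s : G.IndepState | ∑ v, s.queue v ≤ n}.Finite := by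
  have hfin : {q : V → ℕ | q ≤ fun _ => n}.Finite := by
    classical
    exact Set.finite_Iic _
  refine (hfin.preimage IndepState.queue_injective.injOn).subset fun s hs v => ?_
  exact le_trans (Finset.single_le_sum (f := s.queue) (fun _ _ => Nat.zero_le _)
    (Finset.mem_univ v)) hs

lemma exists_longest_neighbor (hG : ∀ i, ∃ j, G.Adj i j) (q : V → ℕ) (i : V) :
    ∃ j, G.Adj i j ∧ ∀ k, G.Adj i k → q k ≤ q j := by
  classical
  obtain ⟨j, hj⟩ := hG i
  obtain ⟨k, hk, hmax⟩ := Finset.exists_max_image (Finset.univ.filter fun k => G.Adj i k) q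
    ⟨j, by simpa using hj⟩
  exact ⟨k, by simpa using hk, fun l hl => hmax l (by simpa using hl)⟩

/-- A class compatible with `i` which has a longest queue. -/
noncomputable def longest (hG : ∀ i, ∃ j, G.Adj i j) (q : V → ℕ) (i : V) : V :=
  (exists_longest_neighbor hG q i).choose

lemma adj_longest (hG : ∀ i, ∃ j, G.Adj i j) (q : V → ℕ) (i : V) :
    G.Adj i (longest hG q i) := (exists_longest_neighbor hG q i).choose_spec.1

lemma le_longest (hG : ∀ i, ∃ j, G.Adj i j) (q : V → ℕ) {i k : V} (hk : G.Adj i k) :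
    q k ≤ q (longest hG q i) := (exists_longest_neighbor hG q i).choose_spec.2 k hk

open Classical in
/-- The queues after the arrival of an item of class `i` under the match-the-longest policy. -/
noncomputable def longestQueue (hG : ∀ i, ∃ j, G.Adj i j) (q : V → ℕ) (i : V) : V → ℕ :=
  if 1 ≤ q (longest hG q i) then
    Function.update q (longest hG q i) (q (longest hG q i) - 1)
  else Function.update q i (q i + 1)

lemma IsIndepQueue.longestQueue {q : V → ℕ} (hq : G.IsIndepQueue q) (hG : ∀ i, ∃ j, G.Adj i j)
    (i : V) : G.IsIndepQueue (longestQueue hG q i) := by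
  classical
  rw [SimpleGraph.longestQueue]
  split_ifs with h
  · refine hq.mono fun k => ?_
    rw [Function.update_apply]
    split_ifs with hk
    · subst hk; exact Nat.sub_le _ _
    · exact le_rfl
  · have h0 : ∀ k, G.Adj i k → q k = 0 := fun k hk => by
      have := le_longest hG q hk
      omega
    intro a b hab
    by_cases ha : a = i
    · subst ha
      right
      rw [Function.update_of_ne hab.ne', h0 b hab]
    · by_cases hb : b = i
      · subst hb
        left
        rw [Function.update_of_ne ha, h0 a hab.symm]
      · rw [Function.update_of_ne ha, Function.update_of_ne hb]
        exact hq a b hab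

/-- The decision of the match-the-longest policy, and the next state. -/
noncomputable def longestStep (hG : ∀ i, ∃ j, G.Adj i j) (s : G.IndepState) (i : V) :
    Option V × G.IndepState :=
  (if 1 ≤ s.queue (longest hG s.queue i) then some (longest hG s.queue i) else none,
    IndepState.ofQueue (longestQueue hG s.queue i) (s.isIndepQueue.longestQueue hG i))

lemma queue_longestStep (hG : ∀ i, ∃ j, G.Adj i j) (s : G.IndepState) (i : V) :
    (longestStep hG s i).2.queue = longestQueue hG s.queue i :=
  IndepState.queue_ofQueue _ (s.isIndepQueue.longestQueue hG i)

lemma sum_update_pred_lt [DecidableEq V] {q : V → ℕ} {v : V} (h : 1 ≤ q v) :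
    ∑ k, Function.update q v (q v - 1) k < ∑ k, q k := by
  refine Finset.sum_lt_sum (fun k _ => ?_) ⟨v, Finset.mem_univ v, ?_⟩
  · rw [Function.update_apply]
    split_ifs with hk
    · subst hk; omega
    · exact le_rfl
  · rw [Function.update_self]
    omega

lemma reachable_zero_of_longestStep (hG : ∀ i, ∃ j, G.Adj i j) (n : ℕ) (s : G.IndepState)
    (hs : ∑ v, s.queue v = n) :
    Relation.ReflTransGen (fun a b => ∃ i, (longestStep hG a i).2 = b) s
      (IndepState.ofQueue 0 isIndepQueue_zero) := by
  classical
  induction n using Nat.strong_induction_on generalizing s with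
  | _ n ih =>
  by_cases h0 : s.queue = 0
  · have : s = IndepState.ofQueue 0 isIndepQueue_zero :=
      IndepState.queue_injective (by rw [h0, IndepState.queue_ofQueue])
    rw [this]
  · obtain ⟨v, hv⟩ := Function.ne_iff.mp h0
    obtain ⟨i, hi⟩ := hG v
    have h1 : 1 ≤ s.queue (longest hG s.queue i) :=
      le_trans (Nat.one_le_iff_ne_zero.mpr hv) (le_longest hG s.queue hi.symm)
    refine Relation.ReflTransGen.head ⟨i, rfl⟩ (ih _ ?_ _ rfl)
    rw [queue_longestStep, longestQueue, if_pos h1, ← hs]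
    exact sum_update_pred_lt h1

lemma reachable_of_longestStep (hG : ∀ i, ∃ j, G.Adj i j) (n : ℕ) (s : G.IndepState)
    (hs : ∑ v, s.queue v = n) :
    Relation.ReflTransGen (fun a b => ∃ i, (longestStep hG a i).2 = b)
      (IndepState.ofQueue 0 isIndepQueue_zero) s := by
  classical
  induction n using Nat.strong_induction_on generalizing s with
  | _ n ih =>
  by_cases h0 : s.queue = 0
  · have : s = IndepState.ofQueue 0 isIndepQueue_zero :=
      IndepState.queue_injective (by rw [h0, IndepState.queue_ofQueue])
    rw [this]
  · obtain ⟨v, hv⟩ := Function.ne_iff.mp h0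
    have hv1 : 1 ≤ s.queue v := Nat.one_le_iff_ne_zero.mpr hv
    -- The last arrival may be one of class `v`, which is queued.
    have hle : Function.update s.queue v (s.queue v - 1) ≤ s.queue := by
      intro k
      rw [Function.update_apply]
      split_ifs with hk
      · subst hk; exact Nat.sub_le _ _
      · exact le_rfl
    let r : G.IndepState := IndepState.ofQueue _ (s.isIndepQueue.mono hle)
    have hr : r.queue = Function.update s.queue v (s.queue v - 1) := IndepState.queue_ofQueue _ _
    refine Relation.ReflTransGen.tail (ih _ ?_ r rfl) ⟨v, IndepState.queue_injective ?_⟩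
    · rw [hr, ← hs]
      exact sum_update_pred_lt hv1
    · have hadj := adj_longest hG r.queue v
      have hzero : ¬ 1 ≤ r.queue (longest hG r.queue v) := by
        have h2 : s.queue (longest hG r.queue v) = 0 := by
          rcases s.isIndepQueue _ _ hadj with h2 | h2
          · exact absurd h2 hv
          · exact h2
        rw [hr] at hadj h2 ⊢
        rw [Function.update_of_ne hadj.ne', h2]
        omega
      rw [queue_longestStep, longestQueue, if_neg hzero, hr, Function.update_self,
        Function.update_idem, Nat.sub_add_cancel hv1, Function.update_eq_self]

open Classical in
/-- The match-the-longest policy, on the states reachable from the empty one. -/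
noncomputable def matchLongest [Nonempty V] (hG : ∀ i, ∃ j, G.Adj i j) : MatchingPolicy G where
  State := G.IndepState
  countable_state := inferInstance
  infinite_state := by
    obtain ⟨v⟩ := ‹Nonempty V›
    have hind : ∀ n : ℕ, G.IsIndepQueue (Pi.single v n) := by
      intro n i j hij
      by_cases hi : i = v
      · right
        rw [Pi.single_eq_of_ne (hi ▸ hij.ne')]
      · left
        rw [Pi.single_eq_of_ne hi]
    refine Infinite.of_injective (fun n => IndepState.ofQueue _ (hind n)) fun m n hmn => ?_
    have := congrArg (fun s => IndepState.queue s v) hmn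
    simpa using this
  queue := IndepState.queue
  empty := IndepState.ofQueue 0 isIndepQueue_zero
  queue_eq_zero_iff s := by
    constructor
    · intro h
      exact IndepState.queue_injective (by rw [h, IndepState.queue_ofQueue])
    · rintro rfl
      exact IndepState.queue_ofQueue _ _
  law s i := PMF.pure (longestStep hG s i)
  queue_none s i s' h k := by
    rw [← PMF.mem_support_iff, PMF.mem_support_pure_iff] at h
    have h1 : none = (longestStep hG s i).1 := congrArg Prod.fst h
    have h2 : s' = (longestStep hG s i).2 := congrArg Prod.snd h
    have h3 : ¬ 1 ≤ s.queue (longest hG s.queue i) := by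
      intro hle
      rw [longestStep, if_pos hle] at h1
      exact absurd h1 (by simp)
    rw [h2, queue_longestStep, longestQueue, if_neg h3, Function.update_apply]
    split_ifs with hk
    · rw [hk]
    · rfl
  adapted s i j s' h := by
    rw [← PMF.mem_support_iff, PMF.mem_support_pure_iff] at h
    have h1 : some j = (longestStep hG s i).1 := congrArg Prod.fst h
    by_cases h3 : 1 ≤ s.queue (longest hG s.queue i)
    · rw [longestStep, if_pos h3] at h1
      rw [Option.some.inj h1]
      exact ⟨adj_longest hG _ _, h3⟩
    · rw [longestStep, if_neg h3] at h1
      exact absurd h1 (by simp)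
  queue_some s i j s' h k := by
    rw [← PMF.mem_support_iff, PMF.mem_support_pure_iff] at h
    have h1 : some j = (longestStep hG s i).1 := congrArg Prod.fst h
    have h2 : s' = (longestStep hG s i).2 := congrArg Prod.snd h
    by_cases h3 : 1 ≤ s.queue (longest hG s.queue i)
    · rw [longestStep, if_pos h3] at h1
      have h4 := Option.some.inj h1
      rw [h2, queue_longestStep, longestQueue, if_pos h3, ← h4, Function.update_apply]
      rw [← h4] at h3
      split_ifs with hk
      · rw [hk]; omega
      · rfl
    · rw [longestStep, if_neg h3] at h1
      exact absurd h1 (by simp)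
  irreducible s s' := by
    have hrel : ∀ a b : G.IndepState, (∃ i, (longestStep hG a i).2 = b) →
        ∃ i j, PMF.pure (longestStep hG a i) (j, b) ≠ 0 := by
      rintro a b ⟨i, rfl⟩
      exact ⟨i, (longestStep hG a i).1, by simp⟩
    exact Relation.ReflTransGen.mono hrel _ _ ((reachable_zero_of_longestStep hG _ s rfl).trans
      (reachable_of_longestStep hG _ s' rfl))

lemma isGreedy_matchLongest [Nonempty V] (hG : ∀ i, ∃ j, G.Adj i j) :
    (matchLongest hG).IsGreedy := by
  classical
  rintro (s : G.IndepState) i ⟨j, hij, hj⟩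
  replace hj : 1 ≤ s.queue j := hj
  refine ENNReal.tsum_eq_zero.mpr fun s' => ?_
  change PMF.pure (longestStep hG s i) (none, s') = 0
  rw [PMF.pure_apply, if_neg]
  intro h
  have h1 : none = (longestStep hG s i).1 := congrArg Prod.fst h
  rw [longestStep, if_pos (le_trans hj (le_longest hG _ hij))] at h1
  exact absurd h1 (by simp)

/-- The change of the quadratic Lyapunov function at an arrival of class `i`. If the item is
matched, then its own queue is empty. -/
lemma sum_sq_longestQueue (hG : ∀ i, ∃ j, G.Adj i j) {q : V → ℕ} (hq : G.IsIndepQueue q) (i : V) :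
    ∑ v, (longestQueue hG q i v : ℝ) ^ 2
      = ∑ v, (q v : ℝ) ^ 2 + 1 - 2 * ((q (longest hG q i) : ℝ) - q i) := by
  classical
  have hupd : ∀ (k : V) (c : ℕ), ∑ v, (Function.update q k c v : ℝ) ^ 2
      = ∑ v, (q v : ℝ) ^ 2 + ((c : ℝ) ^ 2 - (q k : ℝ) ^ 2) := by
    intro k c
    rw [← sub_eq_iff_eq_add', ← Finset.sum_sub_distrib, Finset.sum_eq_single k]
    · rw [Function.update_self]
    · intro v _ hv
      rw [Function.update_of_ne hv, sub_self]
    · simp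
  rw [longestQueue]
  split_ifs with h
  · have h0 : q i = 0 := by
      rcases hq _ _ (adj_longest hG q i) with h0 | h0
      · exact h0
      · omega
    rw [hupd, h0, Nat.cast_sub h]
    push_cast
    ring
  · have h0 : q (longest hG q i) = 0 := by omega
    rw [hupd, h0]
    push_cast
    ring

open Classical in
lemma sum_mul_incMap (x : V → ℝ) (z : G.edgeSet → ℝ) :
    ∑ k, x k * G.incMap z k
      = ∑ e : G.edgeSet, z e * ∑ k, if k ∈ (e : Sym2 V) then x k else 0 := by
  simp_rw [incMap_apply, Finset.mul_sum]
  rw [Finset.sum_comm]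
  refine Finset.sum_congr rfl fun e _ => Finset.sum_congr rfl fun k _ => ?_
  split_ifs <;> ring

lemma exists_adj_of_surjective (hs : Function.Surjective G.incMap) (i : V) : ∃ j, G.Adj i j := by
  classical
  obtain ⟨z, hz⟩ := hs (Pi.single i 1)
  by_contra! hno
  have h1 := congrFun hz i
  rw [incMap_apply, Pi.single_eq_same, Finset.sum_eq_zero] at h1
  · exact zero_ne_one h1
  · rintro ⟨e, he⟩ -
    rw [if_neg]
    intro hi
    obtain ⟨j, rfl⟩ := Sym2.mem_iff_exists.mp hi
    exact hno j he

/-- The drift of the match-the-longest policy dominates the total queue length. With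
`x i = max_{j ∼ i} q j - q i`, the sum of `x` over the ends of each edge is nonnegative, the drift is
the sum of these numbers weighted by a positive solution `y`, and by surjectivity each `x i` is a
combination of them. If `q i > 0`, then `x i = - q i`, as the support of `q` is independent. -/
lemma exists_sum_queue_le (hs : Function.Surjective G.incMap) (hG : ∀ i, ∃ j, G.Adj i j)
    {y : G.edgeSet → ℝ} (hy : ∀ e, 0 < y e) :
    ∃ C : ℝ, 0 < C ∧ ∀ q : V → ℕ, G.IsIndepQueue q →
      ∑ i, (q i : ℝ) ≤ C * ∑ i, ((q (longest hG q i) : ℝ) - q i) * G.incMap y i := by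
  classical
  choose z hz using fun i : V => hs (Pi.single i 1)
  let K : ℝ := ∑ i, ∑ e, |z i e| / y e
  have hK0 : ∀ i e, 0 ≤ |z i e| / y e := fun i e => div_nonneg (abs_nonneg _) (hy e).le
  have hK : ∀ i e, |z i e| ≤ K * y e := by
    intro i e
    rw [← div_le_iff₀ (hy e)]
    calc |z i e| / y e ≤ ∑ e, |z i e| / y e :=
          Finset.single_le_sum (f := fun e => |z i e| / y e) (fun e _ => hK0 i e)
            (Finset.mem_univ e)
      _ ≤ K := Finset.single_le_sum (f := fun i => ∑ e, |z i e| / y e)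
          (fun i _ => Finset.sum_nonneg fun e _ => hK0 i e) (Finset.mem_univ i)
  have hKn : 0 ≤ K := Finset.sum_nonneg fun i _ => Finset.sum_nonneg fun e _ => hK0 i e
  refine ⟨Fintype.card V * K + 1, by positivity, fun q hq => ?_⟩
  let x : V → ℝ := fun i => (q (longest hG q i) : ℝ) - q i
  let S : G.edgeSet → ℝ := fun e => ∑ k, if k ∈ (e : Sym2 V) then x k else 0
  have hS : ∀ e, 0 ≤ S e := by
    rintro ⟨e, he⟩
    induction e using Sym2.ind with
    | _ i j =>
    have hij : G.Adj i j := he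
    have h1 : S ⟨s(i, j), he⟩ = x i + x j := by
      have h2 : ∀ k, (if k ∈ s(i, j) then x k else 0)
          = (if k = i then x k else 0) + (if k = j then x k else 0) := by
        intro k
        by_cases hki : k = i
        · subst hki; simp [hij.ne]
        · simp [hki]
      simp only [S]
      rw [Finset.sum_congr rfl fun k _ => h2 k, Finset.sum_add_distrib]
      simp
    have h2 : (q j : ℝ) ≤ q (longest hG q i) := by exact_mod_cast le_longest hG q hij
    have h3 : (q i : ℝ) ≤ q (longest hG q j) := by exact_mod_cast le_longest hG q hij.symm
    rw [h1]
    simp only [x]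
    linarith
  have hD : ∑ i, x i * G.incMap y i = ∑ e, y e * S e := sum_mul_incMap x y
  have hD0 : 0 ≤ ∑ i, x i * G.incMap y i := by
    rw [hD]
    exact Finset.sum_nonneg fun e _ => mul_nonneg (hy e).le (hS e)
  have hx : ∀ i, |x i| ≤ K * ∑ i, x i * G.incMap y i := by
    intro i
    have h1 : x i = ∑ e, z i e * S e := by
      have := sum_mul_incMap x (z i)
      rw [hz i, Finset.sum_eq_single i] at this
      · simpa using this
      · intro k _ hk
        rw [Pi.single_eq_of_ne hk, mul_zero]
      · simp
    rw [hD, h1, Finset.mul_sum]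
    refine le_trans (Finset.abs_sum_le_sum_abs _ _) (Finset.sum_le_sum fun e _ => ?_)
    rw [abs_mul, abs_of_nonneg (hS e), ← mul_assoc]
    exact mul_le_mul_of_nonneg_right (hK i e) (hS e)
  have hqx : ∀ i, (q i : ℝ) ≤ K * ∑ i, x i * G.incMap y i := by
    intro i
    rcases hq _ _ (adj_longest hG q i) with h0 | h0
    · rw [h0, Nat.cast_zero]
      exact mul_nonneg hKn hD0
    · refine le_trans (le_abs_self _) (le_trans (le_of_eq ?_) (hx i))
      simp only [x, h0, Nat.cast_zero, zero_sub, abs_neg]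
  calc ∑ i, (q i : ℝ) ≤ ∑ _i : V, K * ∑ i, x i * G.incMap y i :=
        Finset.sum_le_sum fun i _ => hqx i
    _ = Fintype.card V * K * ∑ i, x i * G.incMap y i := by
        rw [Finset.sum_const, Finset.card_univ, nsmul_eq_mul, mul_assoc]
    _ ≤ (Fintype.card V * K + 1) * ∑ i, x i * G.incMap y i := by
        rw [add_mul, one_mul]
        linarith

end SimpleGraph

/-! ### Stability of the match-the-longest policy -/

namespace MatchingProblem

open MarkovChain

variable {V : Type*} [Fintype V] [Nonempty V] {M : MatchingProblem V}

/-- The match-the-longest policy is stable if the conservation equation has a positive solution. -/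
theorem isStable_matchLongest (hs : Function.Surjective M.graph.incMap)
    (hG : ∀ i, ∃ j, M.graph.Adj i j) (hM : M.posSolutions.Nonempty) :
    M.IsStable (SimpleGraph.matchLongest hG) := by
  obtain ⟨y, hy1, hy⟩ := hM
  obtain ⟨C, hC, hbound⟩ := SimpleGraph.exists_sum_queue_le hs hG hy
  have hincMap : M.graph.incMap y = M.rate := hy1
  set R : ℝ := ∑ i, M.rate i with hR
  have hRpos : 0 < R := M.sum_rate_pos
  -- The weight of the Lyapunov function for which the drift is at most the negative queue length.
  let κ : ℝ := C * R / 2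
  have hκ : 0 < κ := by positivity
  let L : M.graph.IndepState → ℝ := fun s => ∑ v, (s.queue v : ℝ) ^ 2
  have hL : ∀ s, 0 ≤ L s := fun s => Finset.sum_nonneg fun v _ => sq_nonneg _
  let p : V → ℝ := fun i => (M.arrivalLaw i).toReal
  have hp : ∀ i, R * p i = M.rate i := M.sum_rate_mul_arrivalLaw
  have hp1 : ∑ i, p i = 1 := by
    have : R * ∑ i, p i = R * 1 := by rw [Finset.mul_sum, mul_one]; simp_rw [hp]; rfl
    exact mul_left_cancel₀ hRpos.ne' this
  have hreal : ∀ s : M.graph.IndepState,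
      ∑ i, p i * (κ * L (SimpleGraph.longestStep hG s i).2) + ∑ v, (s.queue v : ℝ)
        ≤ κ * L s + κ := by
    intro s
    have h1 : ∀ i, L (SimpleGraph.longestStep hG s i).2 = L s + 1
        - 2 * ((s.queue (SimpleGraph.longest hG s.queue i) : ℝ) - s.queue i) := by
      intro i
      simp only [L, SimpleGraph.queue_longestStep]
      exact SimpleGraph.sum_sq_longestQueue hG s.isIndepQueue i
    have h2 := hbound s.queue s.isIndepQueue
    rw [hincMap] at h2
    have h3 : ∑ i, p i * (κ * L (SimpleGraph.longestStep hG s i).2)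
        = κ * (L s + 1) * ∑ i, p i - C * ∑ i,
          ((s.queue (SimpleGraph.longest hG s.queue i) : ℝ) - s.queue i) * M.rate i := by
      rw [Finset.mul_sum, Finset.mul_sum, ← Finset.sum_sub_distrib]
      refine Finset.sum_congr rfl fun i _ => ?_
      rw [h1, ← hp]
      simp only [κ]
      ring
    rw [h3, hp1]
    linarith
  obtain ⟨π, hπ, hπ1⟩ := exists_isInvariant_of_drift
    (P := M.transition (SimpleGraph.matchLongest hG))
    (x := (SimpleGraph.matchLongest hG).empty)
    (W := fun s => ENNReal.ofReal (κ * L s)) (q := fun s : M.graph.IndepState =>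
      ((∑ v, s.queue v : ℕ) : ℝ≥0∞)) (b := ENNReal.ofReal κ) ENNReal.ofReal_ne_top
    (fun n => by
      simp only [Nat.cast_le]
      exact SimpleGraph.finite_sum_queue_le n)
    ENNReal.ofReal_ne_top (fun s => by
      rw [tsum_transition_mul, tsum_stepLaw_mul, ← ENNReal.ofReal_add (mul_nonneg hκ.le (hL s))
        hκ.le]
      refine le_trans (le_of_eq ?_) (ENNReal.ofReal_le_ofReal (hreal s))
      rw [ENNReal.ofReal_add (Finset.sum_nonneg fun i _ =>
          mul_nonneg ENNReal.toReal_nonneg (mul_nonneg hκ.le (hL _)))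
        (Finset.sum_nonneg fun v _ => Nat.cast_nonneg _),
        ENNReal.ofReal_sum_of_nonneg fun i _ =>
          mul_nonneg ENNReal.toReal_nonneg (mul_nonneg hκ.le (hL _))]
      congr 1
      · refine Finset.sum_congr rfl fun i _ => ?_
        rw [ENNReal.ofReal_mul ENNReal.toReal_nonneg,
          ENNReal.ofReal_toReal (PMF.apply_ne_top _ _)]
        congr 1
        change ∑' r, PMF.pure (SimpleGraph.longestStep hG s i) r * ENNReal.ofReal (κ * L r.2) = _
        rw [tsum_eq_single (SimpleGraph.longestStep hG s i)]
        · simp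
        · intro r hr
          simp [hr]
      · rw [← Nat.cast_sum, ENNReal.ofReal_natCast])
  exact M.isStable_of_isInvariant _ hπ hπ1

end MatchingProblem

theorem mainTheorem7 {V : Type*} [Fintype V] [Nonempty V] (M : MatchingProblem V)
    (hG : M.graph.IsSurjectiveOnly) (hM : M.IsStabilizable) :
    (∀ Φ : MatchingPolicy M.graph, Φ.IsGreedy → M.IsStable Φ → ∃! μ, M.HasMatchingRates Φ μ) ∧
    M.greedyRates.Nonempty ∧
    M.greedyRates ⊆ M.posSolutions ∧
    IsOpen ((↑) ⁻¹' M.posSolutions : Set M.solutions) ∧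
    Disjoint M.greedyRates (intrinsicFrontier ℝ M.nonnegSolutions) := by
  have hsub : M.greedyRates ⊆ M.posSolutions := by
    rintro μ ⟨Φ, hΦ, hstable, hμ⟩
    rw [hμ.unique hstable.hasMatchingRates]
    exact hstable.excursionRates_mem_posSolutions hΦ
  refine ⟨fun Φ _ hstable => ⟨M.excursionRates Φ, hstable.hasMatchingRates,
    fun ν hν => hν.unique hstable.hasMatchingRates⟩, ?_, hsub, MatchingProblem.isOpen_posSolutions,
    MatchingProblem.disjoint_posSolutions_intrinsicFrontier.mono_left hsub⟩
  obtain ⟨Φ, hΦ⟩ := hM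
  have hadj := SimpleGraph.exists_adj_of_surjective hG.1
  have hstable := MatchingProblem.isStable_matchLongest hG.1 hadj hΦ.posSolutions_nonempty
  exact ⟨_, SimpleGraph.matchLongest hadj, SimpleGraph.isGreedy_matchLongest hadj, hstable,
    hstable.hasMatchingRates⟩
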